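/- Let $(\Omega,\mathfrak F,\mathbb P)$ be a probability space and $\mathbb N=\{1,2,\dots\}$. For each $n\in\mathbb N$ let $\{\xi^{(n)}_{k,j},\ k,j\in\mathbb N\}$ be i.i.d. nonnegative integer valued random variables with finite mean $a_n=\mathbb E\,\xi^{(n)}_{1,1}$ and finite variance $b_n=\operatorname{Var}(\xi^{(n)}_{1,1})$, and let $\{\varepsilon^{(n)}_k,\ k\in\mathbb N\}$ be nonnegative integer valued random variables with finite means $\alpha(n,k)=\mathbb E\,\varepsilon^{(n)}_k$ and finite variances $\beta(n,k)=\operatorname{Var}(\varepsilon^{(n)}_k)$, the family $\{\varepsilon^{(n)}_k\}_k$ being independent of the family $\{\xi^{(n)}_{k,j}\}_{k,j}$. Define $$X^{(n)}_0=0,\qquad X^{(n)}_k=\sum_{j=1}^{X^{(n)}_{k-1}}\xi^{(n)}_{k,j}+\varepsilon^{(n)}_k,\quad k\ge 1,\qquad A(n)=\mathbb E X^{(n)}_n .$$ For $\sigma$-algebras $\mathcal B,\mathcal R\subseteq\mathfrak F$ put $$\psi(\mathcal B,\mathcal R)=\sup\Big\{\Big|\frac{\mathbb P(A\cap B)}{\mathbb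 P(A)\mathbb P(B)}-1\Big| : A\in\mathcal B,\ B\in\mathcal R,\ \mathbb P(A)\mathbb P(B)>0\Big\},$$ $$\psi_n(m)=\sup_{k\ge1}\psi\big(\sigma(\varepsilon^{(n)}_i: i\le k),\ \sigma(\varepsilon^{(n)}_i: i\ge k+m)\big).$$ Suppose that $\psi_n(m)\to0$ as $m\to\infty$ for every $n$ (that is, the immigration is rowwise $\psi$-mixing) and that $\sup_{n\ge1}\sum_{k=1}^\infty\psi_n(k)<\infty$. A sequence is called regularly varying with exponent $\rho$ if it has the form $n^\rho l(n)$, $n\ge1$, where $l:(0,\infty)\to(0,\infty)$ is measurable and slowly varying, i.e. $l(cx)/l(x)\to1$ as $x\to\infty$ for every $c>0$. Suppose that the following conditions hold, where all limits are as $n\to\infty$. - (C1) There are regularly varying sequences $\{\alpha(k)\}_{k\ge1}$ with exponent $\alpha\ge0$ and $\{\beta(k)\}_{k\ge1}$ with exponent $\beta\ge0$ such that for each $s\ge0$ $$\max_{1\le k\le ns}|\alpha(n,k)-\alpha(k)|=o(\alpha(n)),\qquad \max_{1\le k\le ns}|\beta(n,k)-\beta(k)|=o(\beta(n)).$$ -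 (C2) $a_n=1+an^{-1}+o(n^{-1})$ for some $a\in\mathbb R$. - (C3) $b_n=o(\alpha(n))$. - (C4) $\alpha(n)\to\infty$ and $\beta(n)=o(n\alpha^2(n))$. Then, as $n\to\infty$, the processes $X_n(t)=X^{(n)}_{[nt]}/A(n)$, $t\ge0$, where $[x]$ denotes the integer part of $x$, converge weakly in the Skorokhod space $D(\mathbb R_+,\mathbb R)$ (with the $J_1$ topology) to the deterministic function $$\pi_\alpha(t)=\frac{\mu_\alpha(t)}{\mu_\alpha(1)},\qquad \mu_\alpha(t)=\int_0^t u^\alpha e^{a(t-u)}\,du,\qquad t\ge0 .$$ -/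

import Mathlib

open MeasureTheory ProbabilityTheory Filter Topology
open scoped NNReal ENNReal

noncomputable section

/-! ### Regularly varying sequences -/

/-- A slowly varying function at infinity: a measurable function, positive on `(0, ∞)`, with
`l (c x) / l x → 1` as `x → ∞` for every `c > 0`.  (Values at `x ≤ 0` play no role.) -/
structure IsSlowlyVarying (l : ℝ → ℝ) : Prop where
  measurable : Measurable l
  pos : ∀ x : ℝ, 0 < x → 0 < l x
  tendsto : ∀ c : ℝ, 0 < c → Tendsto (fun x : ℝ => l (c * x) / l x) atTop (𝓝 1)

/-- The sequence `x 1, x 2, …` is regularly varying with exponent `ρ`: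
`x n = n ^ ρ * l n` for some slowly varying function `l`. -/
def IsRegularlyVaryingSeq (ρ : ℝ) (x : ℕ+ → ℝ) : Prop :=
  ∃ l : ℝ → ℝ, IsSlowlyVarying l ∧ ∀ n : ℕ+, x n = (n : ℝ) ^ ρ * l (n : ℝ)

/-- For each `s ≥ 0`, `max_{1 ≤ k ≤ n s} |x n k - y k| = o(y n)` as `n → ∞`
(an empty maximum being `0`); used for positive sequences `y`. -/
def RowsApproximate (x : ℕ+ → ℕ+ → ℝ) (y : ℕ+ → ℝ) : Prop :=
  ∀ s : ℝ≥0, ∀ δ : ℝ, 0 < δ → ∀ᶠ n : ℕ+ in atTop,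
    ∀ k : ℕ+, (k : ℝ) ≤ (n : ℝ) * s → |x n k - y k| ≤ δ * y n

/-! ### `ψ`-mixing -/

section Mixing

variable {Ω S : Type*} [MeasurableSpace Ω] [MeasurableSpace S]

/-- The `ψ`-dependence coefficient between two `σ`-algebras, as an extended nonnegative number:
the supremum of `|P(A ∩ B) / (P(A) P(B)) - 1|` over `A ∈ 𝓑`, `B ∈ 𝓡` of positive probability. -/
def psiDependence (P : Measure Ω) (𝓑 𝓡 : MeasurableSpace Ω) : ℝ≥0∞ :=
  ⨆ (A : Set Ω) (B : Set Ω) (_ : MeasurableSet[𝓑] A) (_ : MeasurableSet[𝓡] B)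
    (_ : 0 < P.real A * P.real B),
    ENNReal.ofReal |P.real (A ∩ B) / (P.real A * P.real B) - 1|

/-- The `σ`-algebra generated by the `η i`, `i ∈ I`. -/
abbrev sigmaGenerated (η : ℕ+ → Ω → S) (I : Set ℕ+) : MeasurableSpace Ω :=
  ⨆ i ∈ I, MeasurableSpace.comap (η i) inferInstance

/-- The `ψ`-mixing coefficients `ψ(m) = sup_{k ≥ 1} ψ(σ(η 1, …, η k), σ(η (k+m), η (k+m+1), …))`
of a sequence of random variables. -/
def psiMixingCoeff (P : Measure Ω) (η : ℕ+ → Ω → S) (m : ℕ+) : ℝ≥0∞ :=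
  ⨆ k : ℕ+, psiDependence P (sigmaGenerated η (Set.Iic k)) (sigmaGenerated η (Set.Ici (k + m)))

/-- A sequence of random variables is `ψ`-mixing if its `ψ`-mixing coefficients tend to zero. -/
def IsPsiMixing (P : Measure Ω) (η : ℕ+ → Ω → S) : Prop :=
  Tendsto (psiMixingCoeff P η) atTop (𝓝 0)

end Mixing

/-! ### The Skorokhod space `D(ℝ₊, ℝ)` -/

/-- Right-continuous functions on `[0, ∞)` with left limits (at `0` the filter `𝓝[<] 0` is
trivial, so there is no condition on the left there). -/
def IsCadlag (x : ℝ≥0 → ℝ) : Prop :=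
  ∀ t : ℝ≥0, ContinuousWithinAt x (Set.Ici t) t ∧ ∃ l : ℝ, Tendsto x (𝓝[<] t) (𝓝 l)

/-- The set `D(ℝ₊, ℝ)` of càdlàg functions. -/
structure SkorokhodSpace where
  toFun : ℝ≥0 → ℝ
  isCadlag : IsCadlag toFun

namespace SkorokhodSpace

/-- The paths `y` which, after some time change `τ` (an increasing bijection of `[0, ∞)`) that
moves no time by more than `δ`, are `δ`-close to `x` on `[0, 1/δ]`. -/
def nearby (x : SkorokhodSpace) (δ : ℝ) : Set SkorokhodSpace :=
  {y | ∃ τ : ℝ≥0 ≃o ℝ≥0, (∀ s : ℝ≥0, |((τ s : ℝ≥0) : ℝ) - s| ≤ δ) ∧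
    ∀ s : ℝ≥0, (s : ℝ) ≤ 1 / δ → |y.toFun (τ s) - x.toFun s| ≤ δ}

theorem nearby_mono (x : SkorokhodSpace) {δ δ' : ℝ} (h0 : 0 < δ) (h : δ ≤ δ') :
    x.nearby δ ⊆ x.nearby δ' := by
  rintro y ⟨τ, h1, h2⟩
  exact ⟨τ, fun s => (h1 s).trans h, fun s hs =>
    (h2 s (hs.trans (one_div_le_one_div_of_le h0 h))).trans h⟩

/-- Skorokhod's `J₁` topology on `D(ℝ₊, ℝ)`.  A sequence `y n` is eventually in every
`x.nearby δ`, `δ > 0`, iff there are time changes `τ n` with `sup_s |τ n s - s| → 0` and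
`sup_{s ≤ N} |y n (τ n s) - x s| → 0` for all `N`, which is the usual description of convergence
of sequences for the (metrizable) `J₁` topology; the open sets below are exactly the sets that
are sequentially open for it. -/
instance : TopologicalSpace SkorokhodSpace where
  IsOpen U := ∀ x ∈ U, ∃ δ : ℝ, 0 < δ ∧ x.nearby δ ⊆ U
  isOpen_univ := fun _ _ => ⟨1, one_pos, Set.subset_univ _⟩
  isOpen_inter := by
    rintro U V hU hV x ⟨hxU, hxV⟩
    obtain ⟨δ, h0, hδ⟩ := hU x hxU
    obtain ⟨δ', h0', hδ'⟩ := hV x hxV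
    have hm : 0 < min δ δ' := lt_min h0 h0'
    exact ⟨min δ δ', hm, Set.subset_inter ((x.nearby_mono hm (min_le_left _ _)).trans hδ)
      ((x.nearby_mono hm (min_le_right _ _)).trans hδ')⟩
  isOpen_sUnion := by
    rintro 𝒰 h𝒰 x ⟨U, hU, hxU⟩
    obtain ⟨δ, h0, hδ⟩ := h𝒰 U hU x hxU
    exact ⟨δ, h0, hδ.trans (Set.subset_sUnion_of_mem hU)⟩

instance : MeasurableSpace SkorokhodSpace := borel SkorokhodSpace

instance : BorelSpace SkorokhodSpace := ⟨rfl⟩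

end SkorokhodSpace

/-! ### Step paths -/

/-- `t ↦ x ([r t])` is càdlàg. -/
theorem isCadlag_floor (x : ℕ → ℝ) (r : ℝ≥0) : IsCadlag (fun t : ℝ≥0 => x ⌊r * t⌋₊) := by
  intro t
  have hc : Continuous fun s : ℝ≥0 => r * s := by fun_prop
  constructor
  · have h1 : ∀ᶠ s in 𝓝[≥] t, ⌊r * s⌋₊ = ⌊r * t⌋₊ := by
      have h2 : ∀ᶠ s in 𝓝 t, r * s < ⌊r * t⌋₊ + 1 :=
        hc.continuousAt.eventually_lt continuousAt_const (Nat.lt_floor_add_one _)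
      filter_upwards [nhdsWithin_le_nhds h2, self_mem_nhdsWithin] with s hs hts
      rw [Nat.floor_eq_iff (zero_le)]
      exact ⟨(Nat.floor_le (zero_le)).trans (mul_le_mul_right hts r), hs⟩
    refine (tendsto_const_nhds (x := x ⌊r * t⌋₊)).congr' ?_
    filter_upwards [h1] with s hs
    rw [hs]
  · refine ⟨x (⌈r * t⌉₊ - 1), (tendsto_const_nhds).congr' ?_⟩
    have h2 : ∀ᶠ s in 𝓝[<] t, ⌊r * s⌋₊ = ⌈r * t⌉₊ - 1 := by
      rcases Nat.eq_zero_or_pos ⌈r * t⌉₊ with h0 | h0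
      · have h3 : r * t = 0 := le_antisymm (Nat.ceil_eq_zero.mp h0) (zero_le)
        filter_upwards [self_mem_nhdsWithin] with s hs
        have : r * s ≤ r * t := mul_le_mul_right (le_of_lt hs) r
        have h4 : r * s = 0 := le_antisymm (this.trans h3.le) (zero_le)
        simp [h4, h3]
      · have h3 : ((⌈r * t⌉₊ - 1 : ℕ) : ℝ≥0) < r * t := by
          rw [← Nat.lt_ceil]; omega
        have h5 : ∀ᶠ s in 𝓝 t, ((⌈r * t⌉₊ - 1 : ℕ) : ℝ≥0) < r * s :=
          continuousAt_const.eventually_lt hc.continuousAt h3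
        have hr : 0 < r := by
          rcases eq_or_lt_of_le (zero_le (a := r)) with h | h
          · rw [← h] at h3; simp at h3
          · exact h
        filter_upwards [nhdsWithin_le_nhds h5, self_mem_nhdsWithin] with s hs hst
        rw [Nat.floor_eq_iff (zero_le)]
        refine ⟨hs.le, ?_⟩
        have h6 : r * s < r * t := mul_lt_mul_of_pos_left hst hr
        have h7 : r * t ≤ (⌈r * t⌉₊ : ℝ≥0) := Nat.le_ceil _
        have h8 : ((⌈r * t⌉₊ - 1 : ℕ) : ℝ≥0) + 1 = (⌈r * t⌉₊ : ℝ≥0) := by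
          exact_mod_cast Nat.sub_add_cancel h0
        rw [h8]
        exact h6.trans_le h7
    filter_upwards [h2] with s hs
    rw [hs]

/-- The path `t ↦ x ([n t])` in `D(ℝ₊, ℝ)`. -/
def stepPath (n : ℕ+) (x : ℕ → ℝ) : SkorokhodSpace where
  toFun t := x ⌊((n : ℕ) : ℝ≥0) * t⌋₊
  isCadlag := isCadlag_floor x _

/-! ### Branching processes with immigration -/

section Branching

variable {Ω : Type*}

/-- The branching process with immigration with offspring numbers `ξ k j` and immigration `ε k`:
`X 0 = 0` and `X k = ∑_{j = 1}^{X (k - 1)} ξ k j + ε k` for `k ≥ 1`. -/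
def branchingProcess (ξ : ℕ+ → ℕ+ → Ω → ℕ) (ε : ℕ+ → Ω → ℕ) : ℕ → Ω → ℕ
  | 0 => fun _ => 0
  | k + 1 => fun ω =>
      (∑ j ∈ Finset.range (branchingProcess ξ ε k ω), ξ k.succPNat j.succPNat ω) + ε k.succPNat ω

/-- The path `t ↦ X_{[n t]} / E X_n` of the `n`-th normalized process. -/
def normalizedPath [MeasurableSpace Ω] (P : Measure Ω) (n : ℕ+) (X : ℕ → Ω → ℕ) (ω : Ω) :
    SkorokhodSpace :=
  stepPath n fun k => (X k ω : ℝ) / ∫ ω', (X n ω' : ℝ) ∂P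

end Branching

/-! ### The limit function -/

/-- `μ_α(t) = ∫_0^t u^α e^{a (t - u)} du`. -/
def muFun (a α : ℝ) (t : ℝ) : ℝ :=
  ∫ u in (0 : ℝ)..t, u ^ α * Real.exp (a * (t - u))

theorem continuous_muFun (a : ℝ) {α : ℝ} (hα : 0 ≤ α) : Continuous (muFun a α) := by
  have h : muFun a α =
      fun t => Real.exp (a * t) * ∫ u in (0 : ℝ)..t, u ^ α * Real.exp (-(a * u)) := by
    funext t
    rw [muFun, ← intervalIntegral.integral_const_mul]
    congr 1
    funext u
    rw [mul_sub, sub_eq_add_neg, Real.exp_add]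
    ring
  have hc : Continuous fun u : ℝ => u ^ α * Real.exp (-(a * u)) :=
    (Real.continuous_rpow_const hα).mul (by fun_prop)
  rw [h]
  exact (by fun_prop : Continuous fun t : ℝ => Real.exp (a * t)).mul
    (intervalIntegral.continuous_primitive (fun _ _ => hc.intervalIntegrable _ _) 0)

/-- The path `π_α(t) = μ_α(t) / μ_α(1)` in `D(ℝ₊, ℝ)`. -/
def piPath (a α : ℝ) (hα : 0 ≤ α) : SkorokhodSpace where
  toFun t := muFun a α t / muFun a α 1
  isCadlag := by
    have h : Continuous fun t : ℝ≥0 => muFun a α t / muFun a α 1 :=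
      ((continuous_muFun a hα).comp NNReal.continuous_coe).div_const _
    exact fun t => ⟨h.continuousWithinAt, _, h.continuousAt.tendsto.mono_left nhdsWithin_le_nhds⟩

end

open MeasureTheory ProbabilityTheory Filter Topology
open scoped NNReal ENNReal

noncomputable section

/-! ### Regular variation -/

/-! Fix a row `n`, let `c` be its offspring mean and `D j` the centred reproduction in step `j + 1`.
The recursion is linear, so it can be solved exactly (`branchingProcess_eq_sum`): `X k = c ^ k *
(∑_{j<k} c⁻¹ ^ (j+1) * D j + ∑_{j<k} c⁻¹ ^ (j+1) * ε (j+1))`. Since `n log c → a`, the prefactor at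
`k = [nt]` tends to `e^{at}` uniformly on compacts. As `μ_α(t) = e^{at} ν(t)` with `ν(t) = ∫_0^t u^α
e^{-au} du`, it remains to show that, after division by `n α(n)`, the noise sum vanishes uniformly
on compacts and the immigration sum converges to `ν`. The same formula in expectation gives `A(n) ~
n α(n) e^a ν(1)`.

Noise: the `D j` are martingale differences for a filtration that contains the whole immigration
from the start, and `E (D j)² = b_n E X_j`. Kolmogorov's inequality bounds the maximal noise by a
constant times `n · b_n · n α(n) / (n α(n))² = b_n / α(n) → 0` (`tendsto_measure_branchingNoise`).

Immigration: the mean of the discounted sum is a Riemann sum for `ν`, by Potter's bound and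
dominated convergence (`RowsApproximate.tendsto_weighted_sum`). Under summable `ψ`-mixing its
variance is at most a constant times the sum of the variances (`variance_sum_le_of_psiMixing`),
hence `O(n β(n)) = o((n α(n))²)`. Chebyshev gives convergence in probability at each fixed time. The
sums are nondecreasing in time and `ν` is continuous, so finitely many times control a whole compact
interval.

The limit is deterministic and continuous, so locally uniform convergence in probability, with the
identity as time change, yields weak convergence in `J₁`
(`tendstoInDistribution_const_of_tendsto_measure`). -/

/-- The uniform convergence theorem for slowly varying functions, in additive form. -/
theorem uniform_increment_of_tendsto {h : ℝ → ℝ} (hm : Measurable h)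
    (ht : ∀ u : ℝ, Tendsto (fun x => h (x + u) - h x) atTop (𝓝 0)) {ε : ℝ} (hε : 0 < ε) :
    ∃ X : ℝ, ∀ x ≥ X, ∀ u ∈ Set.Icc (0 : ℝ) 1, |h (x + u) - h x| ≤ ε := by
  set bad : ℝ → Set ℝ := fun x => {u | ε / 2 ≤ |h (x + u) - h x|} with hbad
  have hbm : ∀ x, MeasurableSet (bad x) := fun x =>
    measurableSet_le measurable_const (by fun_prop)
  -- Pointwise convergence gives convergence in measure on a bounded interval, but only along
  -- sequences.
  have hφ : Tendsto (fun x => (volume.restrict (Set.Icc (0 : ℝ) 3)) (bad x)) atTop (𝓝 0) := by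
    refine tendsto_of_seq_tendsto fun x hx => ?_
    have h1 : TendstoInMeasure (volume.restrict (Set.Icc (0 : ℝ) 3))
        (fun n u => h (x n + u) - h (x n)) atTop (fun _ => 0) := by
      refine tendstoInMeasure_of_tendsto_ae (fun n => ?_) (ae_of_all _ fun u => (ht u).comp hx)
      exact Measurable.aestronglyMeasurable (by fun_prop)
    have h2 := tendstoInMeasure_iff_norm.mp h1 (ε / 2) (by positivity)
    simpa [hbad, Real.norm_eq_abs, Function.comp_def] using h2
  have hev := (hφ.eventually (gt_mem_nhds (show (0 : ℝ≥0∞) < 1 by simp)))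
  obtain ⟨X, hX⟩ := eventually_atTop.mp hev
  refine ⟨X, fun x hx u hu => ?_⟩
  by_contra! hcon
  -- If the increment over `u` exceeds `ε`, each `v` in `[1, 3]` splits it at `x + v` into two
  -- increments, one of which is at least `ε / 2`. So an interval of length 2 would be covered by
  -- two sets of measure less than 1.
  have hsub : Set.Icc (1 : ℝ) 3 ⊆ (bad x ∩ Set.Icc 0 3) ∪
      ((fun v => v + -u) ⁻¹' (bad (x + u) ∩ Set.Icc 0 3)) := by
    intro v hv
    by_cases h1 : v ∈ bad x
    · exact Or.inl ⟨h1, by linarith [hv.1], hv.2⟩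
    · refine Or.inr ⟨?_, ?_, ?_⟩
      · by_contra h2
        simp only [hbad, Set.mem_ofPred_eq, not_le] at h1 h2
        have e : x + u + (v + -u) = x + v := by ring
        rw [e] at h2
        have := abs_sub_abs_le_abs_sub (h (x + u) - h x) (h (x + v) - h x)
        have e2 : |(h (x + u) - h x) - (h (x + v) - h x)| = |h (x + v) - h (x + u)| := by
          rw [abs_sub_comm]; congr 1; ring
        linarith
      · linarith [hv.1, hu.2]
      · linarith [hv.2, hu.1]
  have h1 := hX x hx
  have h2 := hX (x + u) (by linarith [hu.1])
  rw [Measure.restrict_apply (hbm _)] at h1 h2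
  have h3 := (measure_mono hsub).trans (measure_union_le (μ := volume) _ _)
  rw [measure_preimage_add_right, Real.volume_Icc] at h3
  have h4 := h3.trans_lt (ENNReal.add_lt_add h1 h2)
  norm_num at h4

/-- A Potter type bound, in additive form. -/
theorem abs_increment_le_of_tendsto {h : ℝ → ℝ} (hm : Measurable h)
    (ht : ∀ u : ℝ, Tendsto (fun x => h (x + u) - h x) atTop (𝓝 0)) {ε : ℝ} (hε : 0 < ε) :
    ∃ X : ℝ, ∀ x ≥ X, ∀ y ≥ x, |h y - h x| ≤ ε * (y - x + 1) := by
  obtain ⟨X, hX⟩ := uniform_increment_of_tendsto hm ht hε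
  refine ⟨X, fun x hx y hy => ?_⟩
  have key : ∀ (N : ℕ) (y : ℝ), x ≤ y → y ≤ x + N → |h y - h x| ≤ ε * N := by
    intro N
    induction N with
    | zero =>
      intro y h1 h2
      have : y = x := by simp at h2; linarith
      simp [this]
    | succ N ih =>
      intro y h1 h2
      push_cast at h2 ⊢
      rcases le_total y (x + N) with h3 | h3
      · exact (ih y h1 h3).trans (by nlinarith)
      · have h4 := ih (x + N) (by simp) le_rfl
        have h5 := hX (x + N) (by linarith [(Nat.cast_nonneg N : (0 : ℝ) ≤ N)]) (y - (x + N))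
          ⟨by linarith, by linarith⟩
        rw [add_sub_cancel] at h5
        calc |h y - h x| = |(h y - h (x + N)) + (h (x + N) - h x)| := by congr 1; ring
          _ ≤ _ := abs_add_le _ _
          _ ≤ ε * (N + 1) := by linarith
  have h1 := key ⌈y - x⌉₊ y hy (by linarith [Nat.le_ceil (y - x)])
  have h2 := Nat.ceil_lt_add_one (sub_nonneg.mpr hy)
  exact h1.trans (by nlinarith)

namespace IsSlowlyVarying

variable {l : ℝ → ℝ}

theorem measurable_log_exp (hl : IsSlowlyVarying l) :
    Measurable fun x => Real.log (l (Real.exp x)) :=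
  Real.measurable_log.comp (hl.measurable.comp Real.measurable_exp)

theorem tendsto_log_exp (hl : IsSlowlyVarying l) (u : ℝ) :
    Tendsto (fun x => Real.log (l (Real.exp (x + u))) - Real.log (l (Real.exp x)))
      atTop (𝓝 0) := by
  have h1 := ((hl.tendsto (Real.exp u) (Real.exp_pos u)).comp Real.tendsto_exp_atTop).log
    one_ne_zero
  rw [Real.log_one] at h1
  refine h1.congr fun x => ?_
  have hp := hl.pos (Real.exp x) (Real.exp_pos x)
  have hp' := hl.pos (Real.exp u * Real.exp x) (by positivity)
  simp only [Function.comp]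
  rw [Real.log_div hp'.ne' hp.ne', add_comm x u, Real.exp_add]

/-- Potter's bound. -/
theorem abs_log_sub_log_le (hl : IsSlowlyVarying l) {ε : ℝ} (hε : 0 < ε) :
    ∃ X : ℝ, 0 < X ∧ ∀ x ≥ X, ∀ y ≥ x,
      |Real.log (l y) - Real.log (l x)| ≤ ε * (Real.log y - Real.log x + 1) := by
  obtain ⟨X, hX⟩ := abs_increment_le_of_tendsto hl.measurable_log_exp hl.tendsto_log_exp hε
  refine ⟨Real.exp X, Real.exp_pos X, fun x hx y hy => ?_⟩
  have hx0 : 0 < x := (Real.exp_pos X).trans_le hx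
  have h := hX (Real.log x) ((Real.le_log_iff_exp_le hx0).mpr hx) (Real.log y)
    (Real.log_le_log hx0 hy)
  rwa [Real.exp_log hx0, Real.exp_log (hx0.trans_le hy)] at h

end IsSlowlyVarying

theorem PNat.tendsto_cast_real_atTop : Tendsto (fun n : ℕ+ => (n : ℝ)) atTop atTop :=
  tendsto_natCast_atTop_atTop.comp tendsto_PNat_val_atTop_atTop

theorem PNat.cast_real_pos (n : ℕ+) : (0 : ℝ) < n := by exact_mod_cast n.pos

theorem PNat.tendsto_floor_add_one_div {u : ℝ} (hu : 0 ≤ u) :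
    Tendsto (fun n : ℕ+ => ((⌊(n : ℝ) * u⌋₊ : ℝ) + 1) / n) atTop (𝓝 u) := by
  have hn0 := PNat.cast_real_pos
  have h1 : Tendsto (fun n : ℕ+ => u + (n : ℝ)⁻¹) atTop (𝓝 (u + 0)) :=
    tendsto_const_nhds.add (tendsto_inv_atTop_zero.comp PNat.tendsto_cast_real_atTop)
  rw [add_zero] at h1
  refine tendsto_of_tendsto_of_tendsto_of_le_of_le tendsto_const_nhds h1 (fun n => ?_)
    (fun n => ?_)
  · rw [le_div_iff₀ (hn0 n), mul_comm]
    exact (Nat.lt_floor_add_one _).le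
  · simp only
    rw [div_le_iff₀ (hn0 n), add_mul, inv_mul_cancel₀ (hn0 n).ne', mul_comm u]
    have := Nat.floor_le (mul_nonneg (hn0 n).le hu)
    linarith

namespace IsRegularlyVaryingSeq

variable {ρ : ℝ} {x : ℕ+ → ℝ}

theorem pos (hx : IsRegularlyVaryingSeq ρ x) (n : ℕ+) : 0 < x n := by
  obtain ⟨l, hl, h⟩ := hx
  rw [h]
  have : (0 : ℝ) < n := by exact_mod_cast n.pos
  exact mul_pos (Real.rpow_pos_of_pos this _) (hl.pos _ this)

/-- The factor `√k` raises the exponent to `ρ + 1/2`, which absorbs the loss `1/2` in Potter's bound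
even when `ρ = 0`. The resulting bound `x k / x n ≤ C √(n / k)` provides the integrable majorant
`u^{-1/2}` for the Riemann sums. -/
theorem exists_mul_sqrt_le (hx : IsRegularlyVaryingSeq ρ x) (hρ : 0 ≤ ρ) (s : ℝ) :
    ∃ C : ℝ, 0 < C ∧ ∀ᶠ n : ℕ+ in atTop, ∀ k : ℕ+, (k : ℝ) ≤ n * s →
      x k * √(k : ℝ) ≤ C * (x n * √(n : ℝ)) := by
  have hxpos := hx.pos
  obtain ⟨l, hl, h⟩ := hx
  have hn0 := PNat.cast_real_pos
  have hypos : ∀ n : ℕ+, 0 < x n * √(n : ℝ) := fun n =>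
    mul_pos (hxpos n) (Real.sqrt_pos.mpr (hn0 n))
  have hlog : ∀ n : ℕ+, Real.log (x n * √(n : ℝ)) =
      (ρ + 1 / 2) * Real.log n + Real.log (l n) := by
    intro n
    have hr : (0 : ℝ) < (n : ℝ) ^ ρ := Real.rpow_pos_of_pos (hn0 n) _
    rw [Real.log_mul (hxpos n).ne' (Real.sqrt_pos.mpr (hn0 n)).ne', h n,
      Real.log_mul hr.ne' (hl.pos _ (hn0 n)).ne', Real.log_rpow (hn0 n), Real.log_sqrt (hn0 n).le]
    ring
  obtain ⟨X, hX0, hX⟩ := hl.abs_log_sub_log_le (ε := 1 / 2) (by norm_num)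
  obtain ⟨K, hK⟩ : ∃ K : ℕ+, X ≤ K :=
    (PNat.tendsto_cast_real_atTop.eventually (eventually_ge_atTop X)).exists
  have hup : ∀ k n : ℕ+, K ≤ k → k ≤ n →
      x k * √(k : ℝ) ≤ Real.exp (1 / 2) * (x n * √(n : ℝ)) := by
    intro k n hKk hkn
    have hkn' : (k : ℝ) ≤ n := by exact_mod_cast hkn
    have hKk' : (K : ℝ) ≤ k := by exact_mod_cast hKk
    have h1 := hX k (hK.trans hKk') n hkn'
    have h2 := Real.log_le_log (hn0 k) hkn'
    rw [← Real.log_le_log_iff (hypos k) (by have := hypos n; positivity),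
      Real.log_mul (Real.exp_pos _).ne' (hypos n).ne', Real.log_exp, hlog, hlog]
    have h3 := (abs_le.mp h1).1
    nlinarith
  set s' := max s 1
  have hs' : 1 ≤ s' := le_max_right _ _
  have hdown : ∀ k n : ℕ+, K ≤ n → n ≤ k → (k : ℝ) ≤ n * s' → x k * √(k : ℝ) ≤
      Real.exp ((ρ + 1) * Real.log s' + 1) * (x n * √(n : ℝ)) := by
    intro k n hKn hnk hks
    have hnk' : (n : ℝ) ≤ k := by exact_mod_cast hnk
    have hKn' : (K : ℝ) ≤ n := by exact_mod_cast hKn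
    have h1 := hX n (hK.trans hKn') k hnk'
    have h2 := Real.log_le_log (hn0 k) hks
    rw [Real.log_mul (hn0 n).ne' (by positivity)] at h2
    rw [← Real.log_le_log_iff (hypos k) (by have := hypos n; positivity),
      Real.log_mul (Real.exp_pos _).ne' (hypos n).ne', Real.log_exp, hlog, hlog]
    have h3 := (abs_le.mp h1).2
    nlinarith
  obtain ⟨M, hM⟩ : ∃ M : ℝ, ∀ k ∈ Finset.Iic K, x k * √(k : ℝ) ≤ M :=
    ⟨∑ k ∈ Finset.Iic K, x k * √(k : ℝ), fun k hk =>
      Finset.single_le_sum (f := fun k : ℕ+ => x k * √(k : ℝ)) (fun i _ => (hypos i).le) hk⟩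
  have hM0 : 0 < M := (hypos K).trans_le (hM K (by simp))
  -- The three summands serve the ranges `K ≤ k ≤ n`, `n ≤ k ≤ n s'` and `k ≤ K`. In the last one
  -- the finite maximum `M` is compared with the value at `K`, which the first range compares with
  -- the value at `n`.
  refine ⟨Real.exp (1 / 2) + Real.exp ((ρ + 1) * Real.log s' + 1) +
    M * Real.exp (1 / 2) / (x K * √(K : ℝ)), ?_, ?_⟩
  · have := hypos K
    positivity
  filter_upwards [eventually_ge_atTop K] with n hn k hk
  have hyn := hypos n
  have hyK := hypos K
  have e1 : 0 ≤ Real.exp (1 / 2) * (x n * √(n : ℝ)) := by positivity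
  have e2 : 0 ≤ Real.exp ((ρ + 1) * Real.log s' + 1) * (x n * √(n : ℝ)) := by positivity
  have e3 : 0 ≤ M * Real.exp (1 / 2) / (x K * √(K : ℝ)) * (x n * √(n : ℝ)) := by positivity
  rw [add_mul, add_mul]
  rcases le_total k n with hkn | hkn
  · rcases le_total K k with hKk | hKk
    · linarith [hup k n hKk hkn]
    · have h1 := hM k (by simpa using hKk)
      have h2 := hup K n le_rfl hn
      have h3 : M ≤ M * Real.exp (1 / 2) / (x K * √(K : ℝ)) * (x n * √(n : ℝ)) := by
        rw [div_mul_eq_mul_div, le_div_iff₀ hyK, mul_assoc]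
        exact mul_le_mul_of_nonneg_left h2 hM0.le
      linarith
  · have h1 := hdown k n hn hkn (hk.trans (mul_le_mul_of_nonneg_left (le_max_left _ _) (hn0 n).le))
    linarith

/-- Slow variation handles the ratio of `l (n u)` to `l n`; Potter's bound then moves from `n u` to
the integer `⌊n u⌋ + 1`, whose logarithm differs by at most 1. -/
theorem tendsto_div (hx : IsRegularlyVaryingSeq ρ x) {u : ℝ} (hu : 0 < u) :
    Tendsto (fun n : ℕ+ => x ⌊(n : ℝ) * u⌋₊.succPNat / x n) atTop (𝓝 (u ^ ρ)) := by
  obtain ⟨l, hl, h⟩ := hx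
  have hn0 := PNat.cast_real_pos
  have hnu : Tendsto (fun n : ℕ+ => (n : ℝ) * u) atTop atTop :=
    PNat.tendsto_cast_real_atTop.atTop_mul_const hu
  have hcast : ∀ n : ℕ+, ((⌊(n : ℝ) * u⌋₊.succPNat : ℕ+) : ℝ) = ⌊(n : ℝ) * u⌋₊ + 1 := by
    intro n; simp
  have hratio := PNat.tendsto_floor_add_one_div hu.le
  have hl1 : Tendsto (fun n : ℕ+ => l ((n : ℝ) * u) / l n) atTop (𝓝 1) := by
    refine ((hl.tendsto u hu).comp PNat.tendsto_cast_real_atTop).congr fun n => ?_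
    simp [mul_comm]
  have hl2 : Tendsto (fun n : ℕ+ => Real.log (l (⌊(n : ℝ) * u⌋₊ + 1)) -
      Real.log (l ((n : ℝ) * u))) atTop (𝓝 0) := by
    rw [Metric.tendsto_nhds]
    intro ε hε
    obtain ⟨X, hX0, hX⟩ := hl.abs_log_sub_log_le (ε := ε / 3) (by positivity)
    filter_upwards [hnu.eventually (eventually_ge_atTop X),
      hnu.eventually (eventually_ge_atTop 1)] with n hn hn1
    have hfl := Nat.lt_floor_add_one ((n : ℝ) * u)
    have hfl' := Nat.floor_le (mul_pos (hn0 n) hu).le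
    have hp := mul_pos (hn0 n) hu
    have h1 := hX _ hn _ hfl.le
    have h2 : Real.log (⌊(n : ℝ) * u⌋₊ + 1) - Real.log ((n : ℝ) * u) ≤ 1 := by
      rw [← Real.log_div (by positivity) hp.ne']
      refine (Real.log_le_sub_one_of_pos (by positivity)).trans ?_
      have : ((⌊(n : ℝ) * u⌋₊ : ℝ) + 1) / ((n : ℝ) * u) ≤ 2 := by
        rw [div_le_iff₀ hp]; linarith
      linarith
    rw [Real.dist_eq, sub_zero]
    nlinarith
  have hl3 := (Real.continuous_exp.tendsto 0).comp hl2
  rw [Real.exp_zero] at hl3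
  have hfin := ((hratio.rpow_const (p := ρ) (Or.inl hu.ne')).mul hl3).mul hl1
  rw [mul_one, mul_one] at hfin
  refine hfin.congr fun n => ?_
  have hp := mul_pos (hn0 n) hu
  have l1 := hl.pos _ hp
  have l2 := hl.pos _ (hn0 n)
  have l3 := hl.pos ((⌊(n : ℝ) * u⌋₊ : ℝ) + 1) (by positivity)
  have r1 : (0 : ℝ) < (n : ℝ) ^ ρ := Real.rpow_pos_of_pos (hn0 n) _
  simp only [Function.comp]
  rw [h, h, hcast, Real.exp_sub, Real.exp_log l3, Real.exp_log l1,
    Real.div_rpow (by positivity) (hn0 n).le]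
  field_simp

end IsRegularlyVaryingSeq

/-! ### Powers of `1 + a / n + o(1 / n)` -/

theorem pow_eq_exp_div_mul {c : ℝ} (hc : 0 < c) (n : ℕ+) (k : ℕ) :
    c ^ k = Real.exp ((k : ℝ) / n * (n * Real.log c)) := by
  have := PNat.cast_real_pos n
  rw [← mul_assoc, div_mul_cancel₀ _ this.ne', Real.exp_nat_mul, Real.exp_log hc]

/-- The bounds `1 - 1/c ≤ log c ≤ c - 1` squeeze `n log c` between `n (c - 1) / c` and `n (c - 1)`.
-/
theorem tendsto_mul_log_of_isLittleO {c : ℕ+ → ℝ} {a : ℝ}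
    (h : (fun n : ℕ+ => c n - (1 + a * (n : ℝ)⁻¹)) =o[atTop] fun n : ℕ+ => (n : ℝ)⁻¹) :
    (∀ᶠ n in atTop, 0 < c n) ∧ Tendsto (fun n : ℕ+ => (n : ℝ) * Real.log (c n)) atTop (𝓝 a) := by
  have hinv : Tendsto (fun n : ℕ+ => (n : ℝ)⁻¹) atTop (𝓝 0) :=
    tendsto_inv_atTop_zero.comp PNat.tendsto_cast_real_atTop
  have h1 : Tendsto (fun n : ℕ+ => (n : ℝ) * (c n - 1)) atTop (𝓝 a) := by
    have h2 := h.tendsto_div_nhds_zero.add_const a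
    rw [zero_add] at h2
    refine h2.congr fun n => ?_
    have := PNat.cast_real_pos n
    field_simp
    ring
  have h2 : Tendsto c atTop (𝓝 1) := by
    have h3 := (h1.mul hinv).add_const 1
    rw [mul_zero, zero_add] at h3
    refine h3.congr fun n => ?_
    have := PNat.cast_real_pos n
    field_simp
    ring
  have hpos : ∀ᶠ n in atTop, 0 < c n := h2.eventually (lt_mem_nhds one_pos)
  refine ⟨hpos, ?_⟩
  have h3 : Tendsto (fun n : ℕ+ => (n : ℝ) * (c n - 1) * (c n)⁻¹) atTop (𝓝 (a * 1⁻¹)) :=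
    h1.mul (h2.inv₀ one_ne_zero)
  rw [inv_one, mul_one] at h3
  refine tendsto_of_tendsto_of_tendsto_of_le_of_le' h3 h1 ?_ ?_
  · filter_upwards [hpos] with n hn
    rw [mul_assoc]
    refine mul_le_mul_of_nonneg_left ?_ (PNat.cast_real_pos n).le
    have := Real.one_sub_inv_le_log_of_pos hn
    rwa [sub_mul, mul_inv_cancel₀ hn.ne', one_mul]
  · filter_upwards [hpos] with n hn
    exact mul_le_mul_of_nonneg_left (Real.log_le_sub_one_of_pos hn) (PNat.cast_real_pos n).le

section Powers

variable {c : ℕ+ → ℝ} {a : ℝ}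

theorem exists_pow_le_of_tendsto_mul_log (hpos : ∀ᶠ n in atTop, 0 < c n)
    (hlog : Tendsto (fun n : ℕ+ => (n : ℝ) * Real.log (c n)) atTop (𝓝 a)) (s : ℝ) :
    ∃ K : ℝ, 0 < K ∧ ∀ᶠ n : ℕ+ in atTop, ∀ k : ℕ, (k : ℝ) ≤ n * s →
      c n ^ k ≤ K ∧ (c n)⁻¹ ^ k ≤ K := by
  refine ⟨Real.exp (s * (|a| + 1)), Real.exp_pos _, ?_⟩
  have h1 := hlog.abs.eventually (gt_mem_nhds (lt_add_one |a|))
  filter_upwards [hpos, h1] with n hn hna k hk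
  have hn0 := PNat.cast_real_pos n
  have h2 : (k : ℝ) / n ≤ s := by rw [div_le_iff₀ hn0, mul_comm]; exact hk
  have h3 : (k : ℝ) / n * |n * Real.log (c n)| ≤ s * (|a| + 1) :=
    mul_le_mul h2 hna.le (abs_nonneg _) ((by positivity : (0 : ℝ) ≤ k / n).trans h2)
  have h4 : |(k : ℝ) / n * (n * Real.log (c n))| ≤ s * (|a| + 1) := by
    rwa [abs_mul, abs_of_nonneg (by positivity : (0 : ℝ) ≤ k / n)]
  rw [inv_pow, pow_eq_exp_div_mul hn n, ← Real.exp_neg]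
  exact ⟨Real.exp_le_exp.mpr ((le_abs_self _).trans h4),
    Real.exp_le_exp.mpr ((neg_le_abs _).trans h4)⟩

theorem tendsto_inv_pow_floor_add_one (hpos : ∀ᶠ n in atTop, 0 < c n)
    (hlog : Tendsto (fun n : ℕ+ => (n : ℝ) * Real.log (c n)) atTop (𝓝 a)) {u : ℝ} (hu : 0 ≤ u) :
    Tendsto (fun n : ℕ+ => (c n)⁻¹ ^ (⌊(n : ℝ) * u⌋₊ + 1)) atTop (𝓝 (Real.exp (-(a * u)))) := by
  have h1 := ((PNat.tendsto_floor_add_one_div hu).mul hlog).neg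
  rw [mul_comm u a] at h1
  refine ((Real.continuous_exp.tendsto _).comp h1).congr' ?_
  filter_upwards [hpos] with n hn
  rw [inv_pow, pow_eq_exp_div_mul hn n, ← Real.exp_neg]
  simp

theorem eventually_abs_pow_floor_sub_exp_le (hpos : ∀ᶠ n in atTop, 0 < c n)
    (hlog : Tendsto (fun n : ℕ+ => (n : ℝ) * Real.log (c n)) atTop (𝓝 a)) {T ε : ℝ} (hε : 0 < ε) :
    ∀ᶠ n : ℕ+ in atTop, ∀ u ∈ Set.Icc (0 : ℝ) T,
      |c n ^ ⌊(n : ℝ) * u⌋₊ - Real.exp (a * u)| ≤ ε := by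
  rcases lt_or_ge T 0 with hT | hT
  · exact Eventually.of_forall fun n u hu => absurd (hu.1.trans hu.2) (not_le.mpr hT)
  have hinv : Tendsto (fun n : ℕ+ => (n : ℝ)⁻¹) atTop (𝓝 0) :=
    tendsto_inv_atTop_zero.comp PNat.tendsto_cast_real_atTop
  have h1 : Tendsto (fun n : ℕ+ => T * |n * Real.log (c n) - a| + |a| * (n : ℝ)⁻¹) atTop (𝓝 0) := by
    have := ((hlog.sub_const a).abs.const_mul T).add (hinv.const_mul |a|)
    simpa using this
  set M := Real.exp (|a| * T)
  have hM : 0 < M := Real.exp_pos _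
  filter_upwards [hpos, h1.eventually (gt_mem_nhds (show 0 < min 1 (ε / (2 * M)) by positivity))]
    with n hn hlt u hu
  have hn0 := PNat.cast_real_pos n
  have hu0 := hu.1
  have hfl := Nat.floor_le (mul_nonneg hn0.le hu0)
  have hfl' := Nat.lt_floor_add_one ((n : ℝ) * u)
  have h2 : (⌊(n : ℝ) * u⌋₊ : ℝ) / n ≤ u := by rw [div_le_iff₀ hn0]; linarith
  have h3 : |(⌊(n : ℝ) * u⌋₊ : ℝ) / n - u| ≤ (n : ℝ)⁻¹ := by
    rw [abs_sub_comm, abs_of_nonneg (by linarith)]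
    rw [sub_le_iff_le_add, ← one_div, ← add_div, le_div_iff₀ hn0]
    linarith
  set q := (⌊(n : ℝ) * u⌋₊ : ℝ) / n
  have hq0 : 0 ≤ q := by positivity
  -- The error in the exponent: it comes from `n log c` versus `a` and from `⌊n u⌋ / n` versus `u`,
  -- both uniformly small for `u ≤ T`.
  set z := q * (n * Real.log (c n)) - a * u with hz
  have h4 : |z| ≤ T * |n * Real.log (c n) - a| + |a| * (n : ℝ)⁻¹ := by
    have e : z = q * (n * Real.log (c n) - a) + a * (q - u) := by rw [hz]; ring
    rw [e]
    refine (abs_add_le _ _).trans ?_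
    rw [abs_mul, abs_mul, abs_of_nonneg hq0]
    exact add_le_add (mul_le_mul_of_nonneg_right (h2.trans hu.2) (abs_nonneg _))
      (mul_le_mul_of_nonneg_left h3 (abs_nonneg _))
  have h5 := h4.trans_lt hlt
  have h6 : |Real.exp z - 1| ≤ 2 * |z| :=
    Real.abs_exp_sub_one_le (h5.le.trans (min_le_left _ _))
  have h7 : Real.exp (a * u) ≤ M := by
    refine Real.exp_le_exp.mpr ((mul_le_mul_of_nonneg_right (le_abs_self a) hu0).trans
      (mul_le_mul_of_nonneg_left hu.2 (abs_nonneg _)))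
  have e : c n ^ ⌊(n : ℝ) * u⌋₊ - Real.exp (a * u) = Real.exp (a * u) * (Real.exp z - 1) := by
    rw [pow_eq_exp_div_mul hn n, mul_sub, ← Real.exp_add, mul_one]
    congr 2
    rw [hz]; ring
  rw [e, abs_mul, abs_of_pos (Real.exp_pos _)]
  calc Real.exp (a * u) * |Real.exp z - 1| ≤ M * (2 * (ε / (2 * M))) :=
        mul_le_mul h7 (h6.trans (by linarith [h5.le.trans (min_le_right _ _)]))
          (abs_nonneg _) hM.le
    _ = ε := by field_simp

end Powers

/-! ### Riemann sums of regularly varying sequences -/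

theorem intervalIntegrable_comp_floor (v : ℕ → ℝ) {r : ℝ} (hr : 0 < r) (N : ℕ) {p q : ℝ}
    (hp : (N : ℝ) / r ≤ p) (hpq : p ≤ q) (hq : q ≤ ((N : ℝ) + 1) / r) :
    IntervalIntegrable (fun u => v ⌊r * u⌋₊) volume p q ∧
      ∫ u in p..q, v ⌊r * u⌋₊ = (q - p) * v N := by
  -- Only almost everywhere: the floor may jump at the right endpoint `q`.
  have key : ∀ᵐ u : ℝ, u ∈ Set.uIoc p q → v N = v ⌊r * u⌋₊ := by
    have h0 : ∀ᵐ u : ℝ, u ≠ q := by simp [ae_iff]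
    filter_upwards [h0] with u hne hu
    rw [Set.uIoc_of_le hpq] at hu
    congr 1
    symm
    rw [Nat.floor_eq_iff (mul_nonneg hr.le (((by positivity : (0 : ℝ) ≤ N / r).trans hp).trans
      hu.1.le))]
    have h1 := hp.trans hu.1.le
    have h2 := (lt_of_le_of_ne hu.2 hne).trans_le hq
    rw [div_le_iff₀ hr] at h1
    rw [lt_div_iff₀ hr] at h2
    constructor <;> linarith
  constructor
  · refine (intervalIntegrable_const (c := v N)).congr_ae ?_
    exact (ae_restrict_iff' measurableSet_uIoc).mpr key
  · rw [← intervalIntegral.integral_congr_ae key]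
    simp

theorem integral_comp_floor (v : ℕ → ℝ) {r t : ℝ} (hr : 0 < r) (ht : 0 ≤ t) :
    ∫ u in (0 : ℝ)..t, v ⌊r * u⌋₊ =
      (∑ j ∈ Finset.range ⌊r * t⌋₊, v j) / r + (t - ⌊r * t⌋₊ / r) * v ⌊r * t⌋₊ := by
  have hstep : ∀ j : ℕ, IntervalIntegrable (fun u => v ⌊r * u⌋₊) volume ((j : ℝ) / r)
      (((j + 1 : ℕ) : ℝ) / r) ∧
      ∫ u in ((j : ℝ) / r)..(((j + 1 : ℕ) : ℝ) / r), v ⌊r * u⌋₊ = v j / r := by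
    intro j
    have h := intervalIntegrable_comp_floor v hr j (p := (j : ℝ) / r)
      (q := ((j + 1 : ℕ) : ℝ) / r) le_rfl (by gcongr; simp) (by push_cast; exact le_rfl)
    refine ⟨h.1, h.2.trans ?_⟩
    push_cast
    field_simp
    ring
  have hsum := intervalIntegral.sum_integral_adjacent_intervals (μ := volume)
    (f := fun u => v ⌊r * u⌋₊) (a := fun j : ℕ => (j : ℝ) / r) (n := ⌊r * t⌋₊)
    (fun j _ => (hstep j).1)
  have hint := IntervalIntegrable.trans_iterate (μ := volume)
    (f := fun u => v ⌊r * u⌋₊) (a := fun j : ℕ => (j : ℝ) / r) (n := ⌊r * t⌋₊)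
    (fun j _ => (hstep j).1)
  have hfl := Nat.floor_le (mul_nonneg hr.le ht)
  have hfl' := Nat.lt_floor_add_one (r * t)
  have hlast := intervalIntegrable_comp_floor v hr ⌊r * t⌋₊ (p := (⌊r * t⌋₊ : ℝ) / r) (q := t)
    le_rfl (by rw [div_le_iff₀ hr]; linarith) (by rw [le_div_iff₀ hr]; linarith)
  simp only [Nat.cast_zero, zero_div] at hsum hint
  rw [← intervalIntegral.integral_add_adjacent_intervals hint hlast.1, ← hsum, hlast.2,
    Finset.sum_div]
  congr 1
  exact Finset.sum_congr rfl fun j _ => (hstep j).2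

/-- The sum is the integral of a step function over `[0, t]` minus a vanishing partial cell. The
step functions converge pointwise by regular variation, and dominated convergence applies with
majorant a multiple of `u^{-1/2}`. -/
theorem IsRegularlyVaryingSeq.tendsto_weighted_sum {ρ : ℝ} {y : ℕ+ → ℝ}
    (hy : IsRegularlyVaryingSeq ρ y) (hρ : 0 ≤ ρ) {c : ℕ+ → ℝ} {a : ℝ}
    (hpos : ∀ᶠ n in atTop, 0 < c n)
    (hlog : Tendsto (fun n : ℕ+ => (n : ℝ) * Real.log (c n)) atTop (𝓝 a)) {t : ℝ} (ht : 0 ≤ t) :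
    Tendsto (fun n : ℕ+ => (∑ j ∈ Finset.range ⌊(n : ℝ) * t⌋₊,
      (c n)⁻¹ ^ (j + 1) * y j.succPNat) / (n * y n)) atTop
      (𝓝 (∫ u in (0 : ℝ)..t, u ^ ρ * Real.exp (-(a * u)))) := by
  rcases ht.eq_or_lt with rfl | ht0
  · simp
  set v : ℕ+ → ℕ → ℝ := fun n j => (c n)⁻¹ ^ (j + 1) * y j.succPNat / y n with hv
  have hlim : ∀ u : ℝ, 0 < u → Tendsto (fun n : ℕ+ => v n ⌊(n : ℝ) * u⌋₊) atTop
      (𝓝 (u ^ ρ * Real.exp (-(a * u)))) := by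
    intro u hu
    rw [mul_comm]
    refine ((tendsto_inv_pow_floor_add_one hpos hlog hu.le).mul (hy.tendsto_div hu)).congr
      fun n => ?_
    simp only [hv]
    ring
  -- The horizon is `t + 1` because the index `⌊n u⌋ + 1` can exceed `n t`.
  obtain ⟨K, hK0, hK⟩ := exists_pow_le_of_tendsto_mul_log hpos hlog (t + 1)
  obtain ⟨C, hC0, hC⟩ := hy.exists_mul_sqrt_le hρ (t + 1)
  have hint : Tendsto (fun n : ℕ+ => ∫ u in (0 : ℝ)..t, v n ⌊(n : ℝ) * u⌋₊) atTop
      (𝓝 (∫ u in (0 : ℝ)..t, u ^ ρ * Real.exp (-(a * u)))) := by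
    refine intervalIntegral.tendsto_integral_filter_of_dominated_convergence
      (fun u => K * C * u ^ (-(1 / 2) : ℝ)) ?_ ?_ ?_ ?_
    · refine Eventually.of_forall fun n => Measurable.aestronglyMeasurable ?_
      exact (measurable_from_nat (f := v n)).comp
        (Nat.measurable_floor.comp (measurable_const_mul _))
    · filter_upwards [hpos, hK, hC] with n hn hKn hCn
      refine ae_of_all _ fun u hu => ?_
      rw [Set.uIoc_of_le ht] at hu
      have hn0 := PNat.cast_real_pos n
      have hn1 : (1 : ℝ) ≤ n := by exact_mod_cast n.pos
      have hu0 := hu.1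
      have hfl := Nat.floor_le (mul_nonneg hn0.le hu0.le)
      have hfl' := Nat.lt_floor_add_one ((n : ℝ) * u)
      have hle : ((⌊(n : ℝ) * u⌋₊ + 1 : ℕ) : ℝ) ≤ n * (t + 1) := by
        push_cast
        nlinarith [mul_le_mul_of_nonneg_left hu.2 hn0.le]
      have h1 := (hKn _ hle).2
      have h2 := hCn ⌊(n : ℝ) * u⌋₊.succPNat hle
      have hyn := hy.pos n
      have hyk := hy.pos ⌊(n : ℝ) * u⌋₊.succPNat
      have h3 : y ⌊(n : ℝ) * u⌋₊.succPNat / y n ≤ C * u ^ (-(1 / 2) : ℝ) := by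
        rw [Real.rpow_neg hu0.le, ← Real.sqrt_eq_rpow, div_le_iff₀ hyn]
        have hsu : 0 < √u := Real.sqrt_pos.mpr hu0
        have hsn : 0 < √(n : ℝ) := Real.sqrt_pos.mpr hn0
        have h4 : √(n : ℝ) * √u ≤ √((⌊(n : ℝ) * u⌋₊.succPNat : ℕ+) : ℝ) := by
          rw [← Real.sqrt_mul hn0.le]
          exact Real.sqrt_le_sqrt (by simpa using hfl'.le)
        have h5 : y ⌊(n : ℝ) * u⌋₊.succPNat * (√(n : ℝ) * √u) ≤ C * (y n * √(n : ℝ)) :=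
          (mul_le_mul_of_nonneg_left h4 hyk.le).trans h2
        rw [mul_assoc, inv_mul_eq_div, ← mul_div_assoc, le_div_iff₀ hsu]
        refine le_of_mul_le_mul_right ?_ hsn
        linarith
      have hv0 : 0 ≤ v n ⌊(n : ℝ) * u⌋₊ := by
        have := inv_pos.mpr hn
        simp only [hv]; positivity
      rw [Real.norm_eq_abs, abs_of_nonneg hv0]
      simp only [hv]
      rw [mul_div_assoc, mul_assoc K]
      exact mul_le_mul h1 h3 (by positivity) hK0.le
    · exact (intervalIntegral.intervalIntegrable_rpow' (by norm_num)).const_mul _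
    · refine ae_of_all _ fun u hu => ?_
      rw [Set.uIoc_of_le ht] at hu
      exact hlim u hu.1
  have htail : Tendsto (fun n : ℕ+ => (t - ⌊(n : ℝ) * t⌋₊ / n) * v n ⌊(n : ℝ) * t⌋₊) atTop
      (𝓝 0) := by
    have h1 : Tendsto (fun n : ℕ+ => t - (⌊(n : ℝ) * t⌋₊ : ℝ) / n) atTop (𝓝 0) := by
      have h2 := ((PNat.tendsto_floor_add_one_div ht).sub
        (tendsto_inv_atTop_zero.comp PNat.tendsto_cast_real_atTop)).const_sub t
      rw [sub_zero, sub_self] at h2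
      refine h2.congr fun n => ?_
      simp only [Function.comp]
      rw [add_div, one_div]
      ring
    simpa using h1.mul (hlim t ht0)
  have hfin := hint.sub htail
  rw [sub_zero] at hfin
  refine hfin.congr fun n => ?_
  rw [integral_comp_floor (v n) (PNat.cast_real_pos n) ht, add_sub_cancel_right]
  simp only [hv]
  rw [← Finset.sum_div, div_div, mul_comm (y n)]

/-- There are at most `n t` terms with weights at most `K`, so an error `o(y n)` per term changes
the sum by `o(n y n)`. -/
theorem RowsApproximate.tendsto_weighted_sum {ρ : ℝ} {x : ℕ+ → ℕ+ → ℝ} {y : ℕ+ → ℝ}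
    (hxy : RowsApproximate x y) (hy : IsRegularlyVaryingSeq ρ y) (hρ : 0 ≤ ρ) {c : ℕ+ → ℝ} {a : ℝ}
    (hpos : ∀ᶠ n in atTop, 0 < c n)
    (hlog : Tendsto (fun n : ℕ+ => (n : ℝ) * Real.log (c n)) atTop (𝓝 a)) {t : ℝ} (ht : 0 ≤ t) :
    Tendsto (fun n : ℕ+ => (∑ j ∈ Finset.range ⌊(n : ℝ) * t⌋₊,
      (c n)⁻¹ ^ (j + 1) * x n j.succPNat) / (n * y n)) atTop
      (𝓝 (∫ u in (0 : ℝ)..t, u ^ ρ * Real.exp (-(a * u)))) := by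
  have h0 := hy.tendsto_weighted_sum hρ hpos hlog ht
  obtain ⟨K, hK0, hK⟩ := exists_pow_le_of_tendsto_mul_log hpos hlog t
  refine (tendsto_iff_of_dist ?_).mpr h0
  rw [Metric.tendsto_nhds]
  intro ε hε
  filter_upwards [hpos, hK, hxy ⟨t, ht⟩ (ε / (2 * (K * (t + 1)))) (by positivity)] with n hn hKn hx
  have hn0 := PNat.cast_real_pos n
  have hyn := hy.pos n
  rw [Real.dist_eq, sub_zero, Real.dist_eq, abs_of_nonneg (abs_nonneg _), ← sub_div,
    ← Finset.sum_sub_distrib, abs_div, abs_of_pos (mul_pos hn0 hyn), div_lt_iff₀ (by positivity)]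
  have hfl := Nat.floor_le (mul_nonneg hn0.le ht)
  calc |∑ j ∈ Finset.range ⌊(n : ℝ) * t⌋₊,
        ((c n)⁻¹ ^ (j + 1) * x n j.succPNat - (c n)⁻¹ ^ (j + 1) * y j.succPNat)|
      ≤ ∑ j ∈ Finset.range ⌊(n : ℝ) * t⌋₊, K * (ε / (2 * (K * (t + 1))) * y n) := by
        refine (Finset.abs_sum_le_sum_abs _ _).trans (Finset.sum_le_sum fun j hj => ?_)
        have hj' : ((j + 1 : ℕ) : ℝ) ≤ n * t :=
          le_trans (by exact_mod_cast Finset.mem_range.mp hj) hfl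
        rw [← mul_sub, abs_mul, abs_of_pos (by have := inv_pos.mpr hn; positivity)]
        exact mul_le_mul (hKn _ hj').2 (hx j.succPNat hj') (abs_nonneg _) hK0.le
    _ = ⌊(n : ℝ) * t⌋₊ * (ε / (2 * (t + 1))) * y n := by
        rw [Finset.sum_const, Finset.card_range, nsmul_eq_mul]
        field_simp
    _ ≤ n * t * (ε / (2 * (t + 1))) * y n := by gcongr
    _ < ε * (n * y n) := by
        have : t * (ε / (2 * (t + 1))) < ε := by
          rw [mul_div_assoc', div_lt_iff₀ (by positivity)]
          nlinarith
        nlinarith [mul_pos hn0 hyn]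

/-! ### Covariance bounds under `ψ`-mixing -/

section PsiMixingCovariance

variable {Ω : Type*} {𝓑 𝓡 : MeasurableSpace Ω} [MeasurableSpace Ω] {P : Measure Ω} [IsProbabilityMeasure P]

theorem abs_sub_le_psiDependence (hψ : psiDependence P 𝓑 𝓡 ≠ ∞)
    {A B : Set Ω} (hA : MeasurableSet[𝓑] A) (hB : MeasurableSet[𝓡] B) :
    |P.real (A ∩ B) - P.real A * P.real B| ≤
      (psiDependence P 𝓑 𝓡).toReal * (P.real A * P.real B) := by
  rcases (mul_nonneg (measureReal_nonneg (μ := P) (s := A))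
    (measureReal_nonneg (μ := P) (s := B))).eq_or_lt with h0 | h0
  · have h1 : P.real (A ∩ B) = 0 := by
      refine le_antisymm ?_ measureReal_nonneg
      rcases mul_eq_zero.mp h0.symm with h | h
      · exact (measureReal_mono Set.inter_subset_left).trans h.le
      · exact (measureReal_mono Set.inter_subset_right).trans h.le
    simp [h1, ← h0]
  · have h1 : ENNReal.ofReal |P.real (A ∩ B) / (P.real A * P.real B) - 1| ≤
        psiDependence P 𝓑 𝓡 :=
      le_iSup_of_le A (le_iSup_of_le B (le_iSup_of_le hA (le_iSup_of_le hB
        (le_iSup_of_le h0 le_rfl))))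
    have h2 := (ENNReal.ofReal_le_iff_le_toReal hψ).mp h1
    have e : P.real (A ∩ B) - P.real A * P.real B =
        (P.real (A ∩ B) / (P.real A * P.real B) - 1) * (P.real A * P.real B) := by
      rw [sub_mul, div_mul_cancel₀ _ h0.ne', one_mul]
    rw [e, abs_mul, abs_of_pos h0]
    exact mul_le_mul_of_nonneg_right h2 h0.le

theorem summable_measureReal_mul {S : Type*} [MeasurableSpace S] [Countable S]
    [MeasurableSingletonClass S] {m : Measure S} {G : S → ℝ} (hG : Integrable G m) :
    Summable fun p => m.real {p} * G p := by
  have h := hasSum_integral_iUnion (μ := m) (s := fun p : S => {p}) (f := G)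
      (fun p => measurableSet_singleton p)
      (fun p q hpq => by simpa using hpq) hG.integrableOn
  simpa only [integral_singleton, smul_eq_mul] using h.summable

/-- On a countable space integrals are sums over atoms, so a relative bound on atoms passes to
integrals term by term. It is applied to a joint law and the product of its marginals. -/
theorem abs_integral_sub_integral_le_of_singleton {S : Type*} [MeasurableSpace S] [Countable S]
    [MeasurableSingletonClass S] {μ ν : Measure S} {F : S → ℝ} {K : ℝ}
    (hμ : Integrable F μ) (hν : Integrable F ν)
    (h : ∀ p, |μ.real {p} - ν.real {p}| ≤ K * ν.real {p}) :
    |∫ p, F p ∂μ - ∫ p, F p ∂ν| ≤ K * ∫ p, |F p| ∂ν := by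
  have hterm : ∀ p, |μ.real {p} * F p - ν.real {p} * F p| ≤ K * (ν.real {p} * |F p|) := by
    intro p
    rw [← sub_mul, abs_mul, ← mul_assoc]
    exact mul_le_mul_of_nonneg_right (h p) (abs_nonneg _)
  have hs : Summable fun p => K * (ν.real {p} * |F p|) :=
    (summable_measureReal_mul hν.abs).mul_left _
  have hs' := Summable.of_nonneg_of_le (fun p => abs_nonneg _) hterm hs
  rw [integral_countable hμ, integral_countable hν, integral_countable hν.abs]
  simp only [smul_eq_mul]
  rw [← (summable_measureReal_mul hμ).tsum_sub (summable_measureReal_mul hν), ← tsum_mul_left]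
  refine le_trans ?_ (hs'.tsum_le_tsum hterm hs)
  rw [← Real.norm_eq_abs]
  refine (norm_tsum_le_tsum_norm ?_).trans_eq ?_
  · exact hs'
  · rfl

/-- For countably valued variables the events `{X = x}` and `{Y = y}` suffice: the `ψ`-coefficient
bounds the difference between the joint law and the product law at each atom, relative to the
product mass. -/
theorem abs_integral_mul_sub_le_psiDependence {S T : Type*} [MeasurableSpace S]
    [MeasurableSpace T] [Countable S] [Countable T] [MeasurableSingletonClass S]
    [MeasurableSingletonClass T] (hψ : psiDependence P 𝓑 𝓡 ≠ ∞)
    {X : Ω → S} {Y : Ω → T} (hX : Measurable X) (hY : Measurable Y)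
    (hX𝓑 : Measurable[𝓑] X) (hY𝓡 : Measurable[𝓡] Y) {f : S → ℝ} {g : T → ℝ}
    (hf : Integrable (fun ω => f (X ω)) P) (hg : Integrable (fun ω => g (Y ω)) P)
    (hfg : Integrable (fun ω => f (X ω) * g (Y ω)) P) :
    |∫ ω, f (X ω) * g (Y ω) ∂P - (∫ ω, f (X ω) ∂P) * ∫ ω, g (Y ω) ∂P| ≤
      (psiDependence P 𝓑 𝓡).toReal * ((∫ ω, |f (X ω)| ∂P) * ∫ ω, |g (Y ω)| ∂P) := by
  have hfm : Measurable f := measurable_of_countable f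
  have hgm : Measurable g := measurable_of_countable g
  have hFm : Measurable fun p : S × T => f p.1 * g p.2 := measurable_of_countable _
  have : IsProbabilityMeasure (P.map X) := Measure.isProbabilityMeasure_map hX.aemeasurable
  have : IsProbabilityMeasure (P.map Y) := Measure.isProbabilityMeasure_map hY.aemeasurable
  have hfX : Integrable f (P.map X) := (integrable_map_measure hfm.aestronglyMeasurable
    hX.aemeasurable).mpr hf
  have hgY : Integrable g (P.map Y) := (integrable_map_measure hgm.aestronglyMeasurable
    hY.aemeasurable).mpr hg
  have hFμ : Integrable (fun p : S × T => f p.1 * g p.2) (P.map fun ω => (X ω, Y ω)) :=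
    (integrable_map_measure hFm.aestronglyMeasurable (hX.prodMk hY).aemeasurable).mpr hfg
  have hFν : Integrable (fun p : S × T => f p.1 * g p.2) ((P.map X).prod (P.map Y)) :=
    hfX.mul_prod hgY
  have key := abs_integral_sub_integral_le_of_singleton (K := (psiDependence P 𝓑 𝓡).toReal)
    hFμ hFν fun p => by
      have h1 : ((P.map X).prod (P.map Y)).real {p} =
          P.real (X ⁻¹' {p.1}) * P.real (Y ⁻¹' {p.2}) := by
        rw [show ({p} : Set (S × T)) = {p.1} ×ˢ {p.2} by simp, measureReal_prod_prod,
          map_measureReal_apply hX (measurableSet_singleton _),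
          map_measureReal_apply hY (measurableSet_singleton _)]
      have h2 : (P.map fun ω => (X ω, Y ω)).real {p} = P.real (X ⁻¹' {p.1} ∩ Y ⁻¹' {p.2}) := by
        rw [map_measureReal_apply (hX.prodMk hY) (measurableSet_singleton _)]
        congr 1
        ext ω
        simp [Prod.ext_iff]
      rw [h1, h2]
      exact abs_sub_le_psiDependence hψ
        (hX𝓑 (measurableSet_singleton _)) (hY𝓡 (measurableSet_singleton _))
  simp_rw [abs_mul] at key
  rw [integral_map (hX.prodMk hY).aemeasurable hFm.aestronglyMeasurable, integral_prod_mul,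
    integral_prod_mul (fun x => |f x|) (fun y => |g y|),
    integral_map hX.aemeasurable hfm.aestronglyMeasurable,
    integral_map hY.aemeasurable hgm.aestronglyMeasurable,
    integral_map hX.aemeasurable hfm.abs.aestronglyMeasurable,
    integral_map hY.aemeasurable hgm.abs.aestronglyMeasurable] at key
  exact key

/-- The variance of a weighted sum of `ψ`-mixing random variables. -/
theorem variance_sum_le_of_psiMixing {η : ℕ+ → Ω → ℕ} (hη : ∀ k, Measurable (η k))
    (hL2 : ∀ k, MemLp (fun ω => (η k ω : ℝ)) 2 P) {Ψ : ℝ≥0∞} (hΨ : Ψ ≠ ∞)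
    (hsum : ∑' k : ℕ+, psiMixingCoeff P η k ≤ Ψ) {w : ℕ → ℝ} {K : ℝ} (k : ℕ)
    (hw : ∀ j < k, |w j| ≤ K) :
    variance (fun ω => ∑ j ∈ Finset.range k, w j * (η j.succPNat ω : ℝ)) P ≤
      K ^ 2 * (1 + 2 * Ψ.toReal) *
        ∑ j ∈ Finset.range k, variance (fun ω => (η j.succPNat ω : ℝ)) P := by
  set ψ : ℕ+ → ℝ := fun m => (psiMixingCoeff P η m).toReal with hψdef
  have hψtop : ∀ m, psiMixingCoeff P η m ≠ ∞ := fun m =>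
    (((ENNReal.le_tsum m).trans hsum).trans_lt hΨ.lt_top).ne
  have hψsum : ∀ s : Finset ℕ+, ∑ m ∈ s, ψ m ≤ Ψ.toReal := by
    intro s
    rw [← ENNReal.toReal_sum fun m _ => hψtop m]
    exact ENNReal.toReal_mono hΨ ((ENNReal.sum_le_tsum s).trans hsum)
  set Z : ℕ → Ω → ℝ := fun j ω => (η j.succPNat ω : ℝ) with hZ
  set m : ℕ → ℝ := fun j => ∫ ω, Z j ω ∂P
  set σ2 : ℕ → ℝ := fun j => variance (Z j) P with hσ2
  have hσ0 : ∀ j, 0 ≤ σ2 j := fun j => variance_nonneg _ _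
  have hZL2 : ∀ j, MemLp (Z j) 2 P := fun j => hL2 _
  have hcL2 : ∀ j, MemLp (fun ω => Z j ω - m j) 2 P := fun j => (hZL2 j).sub (memLp_const _)
  have hσint : ∀ j, ∫ ω, (Z j ω - m j) ^ 2 ∂P = σ2 j := fun j =>
    (variance_eq_integral (hZL2 j).aestronglyMeasurable.aemeasurable).symm
  -- Jensen's inequality, read off from the nonnegativity of the variance of `|Z j - m j|`.
  have habs : ∀ j, ∫ ω, |Z j ω - m j| ∂P ≤ √(σ2 j) := by
    intro j
    refine Real.le_sqrt_of_sq_le ?_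
    have h1 := variance_nonneg (fun ω => |Z j ω - m j|) P
    rw [variance_eq_sub (X := fun ω => |Z j ω - m j|) (hcL2 j).abs] at h1
    simp only [Pi.pow_apply, sq_abs] at h1
    rw [hσint] at h1
    linarith
  -- Mixing at lag `d + 1` bounds the covariance by `ψ` times the product of the first absolute
  -- moments, then AM-GM separates the two variances.
  have hcov : ∀ i d : ℕ, |cov[Z i, Z (i + (d + 1)); P]| ≤
      ψ d.succPNat * ((σ2 i + σ2 (i + (d + 1))) / 2) := by
    intro i d
    set j := i + (d + 1)
    have hle : psiDependence P (sigmaGenerated η (Set.Iic i.succPNat))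
      (sigmaGenerated η (Set.Ici (i.succPNat + d.succPNat))) ≤ psiMixingCoeff P η d.succPNat :=
      le_iSup (fun k : ℕ+ => psiDependence P (sigmaGenerated η (Set.Iic k))
        (sigmaGenerated η (Set.Ici (k + d.succPNat)))) i.succPNat
    have hne : psiDependence P (sigmaGenerated η (Set.Iic i.succPNat))
      (sigmaGenerated η (Set.Ici (i.succPNat + d.succPNat))) ≠ ∞ := (hle.trans_lt (hψtop _).lt_top).ne
    have hm1 : Measurable[sigmaGenerated η (Set.Iic i.succPNat)] (η i.succPNat) := by
      refine Measurable.mono (comap_measurable (η i.succPNat)) ?_ le_rfl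
      exact le_iSup₂_of_le (f := fun k (_ : k ∈ Set.Iic i.succPNat) =>
        MeasurableSpace.comap (η k) inferInstance) i.succPNat (by simp) le_rfl
    have hm2 : Measurable[sigmaGenerated η (Set.Ici (i.succPNat + d.succPNat))] (η j.succPNat) := by
      refine Measurable.mono (comap_measurable (η j.succPNat)) ?_ le_rfl
      refine le_iSup₂_of_le (f := fun k (_ : k ∈ Set.Ici (i.succPNat + d.succPNat)) =>
        MeasurableSpace.comap (η k) inferInstance) j.succPNat ?_ le_rfl
      rw [Set.mem_Ici, ← PNat.coe_le_coe]
      simp only [PNat.add_coe, Nat.succPNat_coe, Nat.succ_eq_add_one, j]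
      omega
    have h1 := abs_integral_mul_sub_le_psiDependence hne (hη _) (hη _) hm1 hm2
      (f := fun x : ℕ => (x : ℝ) - m i) (g := fun x : ℕ => (x : ℝ) - m j)
      ((hcL2 i).integrable one_le_two) ((hcL2 j).integrable one_le_two)
      ((hcL2 i).integrable_mul (hcL2 j))
    have h2 : ∀ j, ∫ ω, ((η j.succPNat ω : ℝ) - m j) ∂P = 0 := by
      intro j
      rw [integral_sub ((hZL2 j).integrable one_le_two) (integrable_const _)]
      simp [m, Z]
    rw [h2, zero_mul, sub_zero] at h1
    have h3 : cov[Z i, Z j; P] =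
        ∫ ω, ((η i.succPNat ω : ℝ) - m i) * ((η j.succPNat ω : ℝ) - m j) ∂P := rfl
    rw [h3]
    refine h1.trans (mul_le_mul (ENNReal.toReal_mono (hψtop _) hle) ?_ ?_ ENNReal.toReal_nonneg)
    · refine (mul_le_mul (habs i) (habs j) (integral_nonneg fun _ => abs_nonneg _)
        (Real.sqrt_nonneg _)).trans ?_
      nlinarith [sq_nonneg (√(σ2 i) - √(σ2 j)), Real.sq_sqrt (hσ0 i), Real.sq_sqrt (hσ0 j)]
    · exact mul_nonneg (integral_nonneg fun _ => abs_nonneg _)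
        (integral_nonneg fun _ => abs_nonneg _)
  -- A symmetric kernel `ψ(|i - j|)` with value 1 on the diagonal. Its row sums are at most `1 +
  -- 2Ψ`, one `Ψ` for each side; by symmetry the row-sum bound then controls the whole quadratic
  -- form.
  set φ : ℕ → ℕ → ℝ := fun i j => if h : i < j then ψ (j - i - 1).succPNat else
    if j < i then ψ (i - j - 1).succPNat else 1 with hφ
  have hψ0 : ∀ m, 0 ≤ ψ m := fun m => ENNReal.toReal_nonneg
  have hφsymm : ∀ i j, φ i j = φ j i := by
    intro i j
    rcases lt_trichotomy i j with h | h | h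
    · simp [hφ, h, h.not_gt]
    · simp [h]
    · simp [hφ, h, h.not_gt]
  have hφcov : ∀ i j, |cov[Z i, Z j; P]| ≤ φ i j * ((σ2 i + σ2 j) / 2) := by
    have hlt : ∀ i j, i < j → |cov[Z i, Z j; P]| ≤ φ i j * ((σ2 i + σ2 j) / 2) := by
      intro i j h
      have h1 := hcov i (j - i - 1)
      rw [show i + (j - i - 1 + 1) = j by omega] at h1
      simpa [hφ, h] using h1
    intro i j
    rcases lt_trichotomy i j with h | h | h
    · exact hlt i j h
    · subst h
      rw [covariance_self (hZL2 i).aestronglyMeasurable.aemeasurable, abs_of_nonneg (hσ0 i)]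
      simp [hφ, hσ2]
    · rw [covariance_comm, hφsymm, add_comm]
      exact hlt j i h
  have hφsum : ∀ i, ∑ j ∈ Finset.range k, φ i j ≤ 1 + 2 * Ψ.toReal := by
    intro i
    have h1 : ∀ j, φ i j = (if i < j then ψ (j - i - 1).succPNat else 0) +
        (if j < i then ψ (i - j - 1).succPNat else 0) + (if j = i then 1 else 0) := by
      intro j
      rcases lt_trichotomy i j with h | h | h
      · simp [hφ, h, h.not_gt, h.ne']
      · simp [hφ, h]
      · simp [hφ, h, h.not_gt, h.ne]
    simp_rw [h1]
    rw [Finset.sum_add_distrib, Finset.sum_add_distrib]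
    have h2 : ∑ j ∈ Finset.range k, (if i < j then ψ (j - i - 1).succPNat else 0) ≤ Ψ.toReal := by
      rw [← Finset.sum_filter]
      refine le_trans (le_of_eq ?_) (hψsum
        (({j ∈ Finset.range k | i < j}).image fun j => (j - i - 1).succPNat))
      rw [Finset.sum_image]
      intro x hx y hy hxy
      simp only [Finset.coe_filter, Finset.mem_range, Set.mem_ofPred_eq] at hx hy
      have := Nat.succPNat_inj.mp hxy
      omega
    have h3 : ∑ j ∈ Finset.range k, (if j < i then ψ (i - j - 1).succPNat else 0) ≤ Ψ.toReal := by
      rw [← Finset.sum_filter]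
      refine le_trans (le_of_eq ?_) (hψsum
        (({j ∈ Finset.range k | j < i}).image fun j => (i - j - 1).succPNat))
      rw [Finset.sum_image]
      intro x hx y hy hxy
      simp only [Finset.coe_filter, Finset.mem_range, Set.mem_ofPred_eq] at hx hy
      have := Nat.succPNat_inj.mp hxy
      omega
    have h4 : ∑ j ∈ Finset.range k, (if j = i then (1 : ℝ) else 0) ≤ 1 := by
      rw [Finset.sum_ite_eq']
      split_ifs <;> norm_num
    linarith
  have hvar : variance (fun ω => ∑ j ∈ Finset.range k, w j * Z j ω) P =
      ∑ i ∈ Finset.range k, ∑ j ∈ Finset.range k, w i * w j * cov[Z i, Z j; P] := by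
    have h1 := variance_fun_sum' (μ := P) (s := Finset.range k) (X := fun j ω => w j * Z j ω)
      (fun j _ => (hZL2 j).const_mul _)
    rw [h1]
    refine Finset.sum_congr rfl fun i _ => Finset.sum_congr rfl fun j _ => ?_
    rw [covariance_const_mul_left, covariance_const_mul_right]
    ring
  rw [hvar]
  calc ∑ i ∈ Finset.range k, ∑ j ∈ Finset.range k, w i * w j * cov[Z i, Z j; P]
      ≤ ∑ i ∈ Finset.range k, ∑ j ∈ Finset.range k,
          K ^ 2 * (φ i j * ((σ2 i + σ2 j) / 2)) := by
        refine Finset.sum_le_sum fun i hi => Finset.sum_le_sum fun j hj => ?_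
        refine (le_abs_self _).trans ?_
        rw [abs_mul, abs_mul, sq]
        have hwi := hw i (Finset.mem_range.mp hi)
        have hwj := hw j (Finset.mem_range.mp hj)
        have hK : 0 ≤ K := (abs_nonneg _).trans hwi
        exact mul_le_mul (mul_le_mul hwi hwj (abs_nonneg _) hK) (hφcov i j) (abs_nonneg _)
          (mul_nonneg hK hK)
    _ = K ^ 2 * ∑ i ∈ Finset.range k, σ2 i * ∑ j ∈ Finset.range k, φ i j := by
        have h1 : ∑ i ∈ Finset.range k, ∑ j ∈ Finset.range k, φ i j * σ2 j =
            ∑ i ∈ Finset.range k, ∑ j ∈ Finset.range k, φ i j * σ2 i := by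
          rw [Finset.sum_comm]
          exact Finset.sum_congr rfl fun i _ => Finset.sum_congr rfl fun j _ => by rw [hφsymm]
        simp_rw [← Finset.mul_sum]
        congr 1
        have h2 : ∀ i j, φ i j * ((σ2 i + σ2 j) / 2) = φ i j * σ2 i / 2 + φ i j * σ2 j / 2 := by
          intro i j; ring
        simp_rw [h2, Finset.sum_add_distrib, ← Finset.sum_div]
        rw [h1, add_halves]
        simp_rw [Finset.mul_sum, mul_comm]
    _ ≤ K ^ 2 * ∑ i ∈ Finset.range k, σ2 i * (1 + 2 * Ψ.toReal) := by
        gcongr with i hi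
        · exact hσ0 i
        · exact hφsum i
    _ = _ := by
        rw [← Finset.sum_mul]
        ring

end PsiMixingCovariance

/-! ### Random sums -/

section RandomSums

variable {Ω : Type*} {m₁ m₂ m₃ : MeasurableSpace Ω}

/-- The intersections `A ∩ E` form a π-system generating `m₁ ⊔ m₃`, and on them the product formula
follows by splitting off `E` first. It is used with past offspring, next offspring and immigration
as `m₁`, `m₂`, `m₃`. -/
theorem ProbabilityTheory.Indep.sup_left_of_sup_left {mΩ : MeasurableSpace Ω} {P : Measure Ω}
    [IsProbabilityMeasure P] (h1 : m₁ ≤ mΩ) (h2 : m₂ ≤ mΩ) (h3 : m₃ ≤ mΩ)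
    (h12 : Indep m₁ m₂ P) (h123 : Indep (m₁ ⊔ m₂) m₃ P) : Indep (m₁ ⊔ m₃) m₂ P := by
  set p : Set (Set Ω) := {s | ∃ A E, MeasurableSet[m₁] A ∧ MeasurableSet[m₃] E ∧ s = A ∩ E} with hp
  have hpi : IsPiSystem p := by
    rintro _ ⟨A, E, hA, hE, rfl⟩ _ ⟨A', E', hA', hE', rfl⟩ _
    exact ⟨A ∩ A', E ∩ E', hA.inter hA', hE.inter hE', by ext; simp; tauto⟩
  have hgen : m₁ ⊔ m₃ = MeasurableSpace.generateFrom p := by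
    refine le_antisymm (sup_le (fun A hA => ?_) (fun E hE => ?_))
      (MeasurableSpace.generateFrom_le ?_)
    · exact MeasurableSpace.measurableSet_generateFrom ⟨A, Set.univ, hA, MeasurableSet.univ, by simp⟩
    · exact MeasurableSpace.measurableSet_generateFrom ⟨Set.univ, E, MeasurableSet.univ, hE, by simp⟩
    · rintro _ ⟨A, E, hA, hE, rfl⟩
      exact MeasurableSet.inter ((le_sup_left : m₁ ≤ m₁ ⊔ m₃) _ hA)
        ((le_sup_right : m₃ ≤ m₁ ⊔ m₃) _ hE)
  refine IndepSets.indep (sup_le h1 h3) h2 hpi (@MeasurableSpace.isPiSystem_measurableSet Ω m₂)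
    hgen (@MeasurableSpace.generateFrom_measurableSet Ω m₂).symm ?_
  rw [IndepSets_iff]
  rintro _ B ⟨A, E, hA, hE, rfl⟩ hB
  rw [Indep_iff] at h12 h123
  have hA' := (le_sup_left : m₁ ≤ m₁ ⊔ m₂) _ hA
  have hB' := (le_sup_right : m₂ ≤ m₁ ⊔ m₂) _ hB
  rw [Set.inter_right_comm, h123 _ _ (MeasurableSet.inter hA' hB') hE, h12 _ _ hA hB,
    h123 _ _ hA' hE, mul_right_comm]

theorem measurable_sum_range_random {M : Type*} [AddCommMonoid M] [MeasurableSpace M]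
    [MeasurableAdd₂ M] {mΩ : MeasurableSpace Ω} {N : Ω → ℕ} {ζ : ℕ → Ω → M}
    (hN : Measurable N) (hζ : ∀ j, Measurable (ζ j)) :
    Measurable fun ω => ∑ j ∈ Finset.range (N ω), ζ j ω := by
  have h : Measurable fun p : ℕ × Ω => ∑ j ∈ Finset.range p.1, ζ j p.2 :=
    measurable_from_prod_countable_right fun x =>
      Finset.measurable_fun_sum (Finset.range x) fun j _ => hζ j
  exact h.comp (hN.prodMk measurable_id)

theorem indepFun_of_indep {mΩ : MeasurableSpace Ω} {P : Measure Ω} {S T : Type*}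
    [MeasurableSpace S] [MeasurableSpace T] {U : Ω → S} {V : Ω → T} (h : Indep m₁ m₂ P)
    (hU : Measurable[m₁] U) (hV : Measurable[m₂] V) : IndepFun U V P := by
  rw [IndepFun_iff_Indep]
  exact indep_of_indep_of_le h hU.comap_le hV.comap_le

variable {mΩ : MeasurableSpace Ω} {P : Measure Ω}
  {N : Ω → ℕ} {ζ : ℕ → Ω → ℝ}

/-- On `{N = x}` the sum has fixed length, hence is independent of `G` restricted to that event and
has mean zero. Integrability of the whole product allows summation over `x`. -/
theorem integral_mul_random_sum_eq_zero (h1 : m₁ ≤ mΩ) (h2 : m₂ ≤ mΩ) (h12 : Indep m₁ m₂ P)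
    (hN : Measurable[m₁] N) (hζ : ∀ j, Measurable[m₂] (ζ j)) (hζint : ∀ j, Integrable (ζ j) P)
    (hmean : ∀ j, ∫ ω, ζ j ω ∂P = 0) {G : Ω → ℝ} (hG : Measurable[m₁] G)
    (hint : Integrable (fun ω => G ω * ∑ j ∈ Finset.range (N ω), ζ j ω) P) :
    ∫ ω, G ω * ∑ j ∈ Finset.range (N ω), ζ j ω ∂P = 0 := by
  have hcover : (⋃ x : ℕ, N ⁻¹' {x}) = Set.univ := by ext; simp
  have hms : ∀ x : ℕ, MeasurableSet[m₁] (N ⁻¹' {x}) := fun x => hN (measurableSet_singleton x)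
  have hsum := hasSum_integral_iUnion (μ := P) (s := fun x : ℕ => N ⁻¹' {x})
    (fun x => h1 _ (hms x))
    (fun x y hxy => Disjoint.preimage _ (by simpa using hxy)) (by rw [hcover]; exact hint.integrableOn)
  rw [hcover, setIntegral_univ] at hsum
  refine hsum.unique ?_
  have hzero : ∀ x : ℕ, ∫ ω in N ⁻¹' {x}, G ω * ∑ j ∈ Finset.range (N ω), ζ j ω ∂P = 0 := by
    intro x
    rw [← integral_indicator (h1 _ (hms x))]
    have e : (N ⁻¹' {x}).indicator (fun ω => G ω * ∑ j ∈ Finset.range (N ω), ζ j ω) =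
        fun ω => (N ⁻¹' {x}).indicator G ω * ∑ j ∈ Finset.range x, ζ j ω := by
      funext ω
      by_cases h : N ω = x
      · rw [Set.indicator_of_mem (by simpa using h), Set.indicator_of_mem (by simpa using h), h]
      · rw [Set.indicator_of_notMem (by simpa using h), Set.indicator_of_notMem (by simpa using h),
          zero_mul]
    have hU : Measurable[m₁] ((N ⁻¹' {x}).indicator G) := Measurable.indicator hG (hms x)
    have hV : Measurable[m₂] fun ω => ∑ j ∈ Finset.range x, ζ j ω :=
      Finset.measurable_fun_sum _ fun j _ => hζ j
    rw [e, (indepFun_of_indep h12 hU hV).integral_fun_mul_eq_mul_integral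
      (hU.mono h1 le_rfl).aestronglyMeasurable (hV.mono h2 le_rfl).aestronglyMeasurable,
      integral_finsetSum _ fun j _ => hζint j, Finset.sum_eq_zero fun j _ => hmean j, mul_zero]
  simp only [hzero]
  exact hasSum_zero

/-- Wald's second identity, again by splitting over the values of `N`. The lower integral makes it
available before square integrability is known; `memLp_random_sum` deduces that from a first moment
of `N` alone. -/
theorem lintegral_random_sum_sq [IsProbabilityMeasure P] (h1 : m₁ ≤ mΩ) (h2 : m₂ ≤ mΩ) (h12 : Indep m₁ m₂ P)
    (hN : Measurable[m₁] N) (hζ : ∀ j, Measurable[m₂] (ζ j)) (hζ2 : ∀ j, MemLp (ζ j) 2 P)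
    (hmean : ∀ j, ∫ ω, ζ j ω ∂P = 0) {b : ℝ} (hvar : ∀ j, variance (ζ j) P = b)
    (hindep : Pairwise fun i j => IndepFun (ζ i) (ζ j) P) :
    ∫⁻ ω, ENNReal.ofReal ((∑ j ∈ Finset.range (N ω), ζ j ω) ^ 2) ∂P =
      ∫⁻ ω, ENNReal.ofReal (N ω * b) ∂P := by
  have hcover : (⋃ x : ℕ, N ⁻¹' {x}) = Set.univ := by ext; simp
  have hms : ∀ x : ℕ, MeasurableSet[m₁] (N ⁻¹' {x}) := fun x => hN (measurableSet_singleton x)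
  have hsplit : ∀ F : Ω → ℝ≥0∞, ∫⁻ ω, F ω ∂P = ∑' x : ℕ, ∫⁻ ω in N ⁻¹' {x}, F ω ∂P := by
    intro F
    rw [← lintegral_iUnion (fun x => h1 _ (hms x))
      (fun x y hxy => Disjoint.preimage _ (by simpa using hxy)), hcover, Measure.restrict_univ]
  rw [hsplit, hsplit]
  refine tsum_congr fun x => ?_
  have hV : Measurable[m₂] fun ω => ∑ j ∈ Finset.range x, ζ j ω :=
    Finset.measurable_fun_sum _ fun j _ => hζ j
  have hV2 : MemLp (fun ω => ∑ j ∈ Finset.range x, ζ j ω) 2 P := memLp_finsetSum _ fun j _ => hζ2 j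
  have hsecond : ∫⁻ ω, ENNReal.ofReal ((∑ j ∈ Finset.range x, ζ j ω) ^ 2) ∂P =
      ENNReal.ofReal (x * b) := by
    rw [← ofReal_integral_eq_lintegral_ofReal hV2.integrable_sq (ae_of_all _ fun _ => sq_nonneg _)]
    congr 1
    have h3 := IndepFun.variance_sum (s := Finset.range x) (fun j _ => hζ2 j)
      (fun i _ j _ hij => hindep hij)
    rw [show (∑ j ∈ Finset.range x, ζ j) = fun ω => ∑ j ∈ Finset.range x, ζ j ω by ext; simp,
      variance_of_integral_eq_zero hV2.aestronglyMeasurable.aemeasurable] at h3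
    · rw [h3, Finset.sum_congr rfl fun j _ => hvar j]
      simp
    · rw [integral_finsetSum _ fun j _ => (hζ2 j).integrable one_le_two,
        Finset.sum_eq_zero fun j _ => hmean j]
  have hcongr : ∀ F : ℕ → Ω → ℝ≥0∞, ∫⁻ ω in N ⁻¹' {x}, F (N ω) ω ∂P =
      ∫⁻ ω in N ⁻¹' {x}, F x ω ∂P := fun F =>
    setLIntegral_congr_fun (h1 _ (hms x)) fun ω hω => by
      have : N ω = x := hω
      simp only [this]
  rw [hcongr fun y ω => ENNReal.ofReal ((∑ j ∈ Finset.range y, ζ j ω) ^ 2),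
    hcongr fun y _ => ENNReal.ofReal (y * b), setLIntegral_const, ← hsecond,
    ← lintegral_indicator (h1 _ (hms x))]
  have e : (N ⁻¹' {x}).indicator (fun ω => ENNReal.ofReal ((∑ j ∈ Finset.range x, ζ j ω) ^ 2)) =
      (N ⁻¹' {x}).indicator 1 * fun ω => ENNReal.ofReal ((∑ j ∈ Finset.range x, ζ j ω) ^ 2) := by
    funext ω
    by_cases h : N ω = x <;> simp [h]
  have hU : Measurable[m₁] ((N ⁻¹' {x}).indicator (1 : Ω → ℝ≥0∞)) :=
    Measurable.indicator measurable_const (hms x)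
  have hW : Measurable[m₂] fun ω => ENNReal.ofReal ((∑ j ∈ Finset.range x, ζ j ω) ^ 2) :=
    ENNReal.measurable_ofReal.comp (hV.pow_const 2)
  rw [e, lintegral_mul_eq_lintegral_mul_lintegral_of_indepFun (hU.mono h1 le_rfl)
    (hW.mono h2 le_rfl) (indepFun_of_indep h12 hU hW), lintegral_indicator_one (h1 _ (hms x)),
    mul_comm]

theorem memLp_random_sum [IsProbabilityMeasure P] (h1 : m₁ ≤ mΩ) (h2 : m₂ ≤ mΩ) (h12 : Indep m₁ m₂ P)
    (hN : Measurable[m₁] N) (hNint : Integrable (fun ω => (N ω : ℝ)) P)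
    (hζ : ∀ j, Measurable[m₂] (ζ j)) (hζ2 : ∀ j, MemLp (ζ j) 2 P)
    (hmean : ∀ j, ∫ ω, ζ j ω ∂P = 0) {b : ℝ} (hvar : ∀ j, variance (ζ j) P = b)
    (hindep : Pairwise fun i j => IndepFun (ζ i) (ζ j) P) :
    MemLp (fun ω => ∑ j ∈ Finset.range (N ω), ζ j ω) 2 P ∧
      ∫ ω, (∑ j ∈ Finset.range (N ω), ζ j ω) ^ 2 ∂P = b * ∫ ω, (N ω : ℝ) ∂P := by
  have hb : 0 ≤ b := hvar 0 ▸ variance_nonneg _ _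
  have hm : Measurable fun ω => ∑ j ∈ Finset.range (N ω), ζ j ω :=
    measurable_sum_range_random (hN.mono h1 le_rfl) fun j => (hζ j).mono h2 le_rfl
  have key := lintegral_random_sum_sq h1 h2 h12 hN hζ hζ2 hmean hvar hindep
  have hNb : Integrable (fun ω => (N ω : ℝ) * b) P := hNint.mul_const b
  rw [← ofReal_integral_eq_lintegral_ofReal hNb (ae_of_all _ fun _ => by positivity),
    integral_mul_const] at key
  have hint : Integrable (fun ω => (∑ j ∈ Finset.range (N ω), ζ j ω) ^ 2) P := by
    refine ⟨(hm.pow_const 2).aestronglyMeasurable, ?_⟩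
    rw [hasFiniteIntegral_iff_ofReal (ae_of_all _ fun _ => sq_nonneg _), key]
    exact ENNReal.ofReal_lt_top
  refine ⟨(memLp_two_iff_integrable_sq hm.aestronglyMeasurable).mpr hint, ?_⟩
  rw [← ofReal_integral_eq_lintegral_ofReal hint (ae_of_all _ fun _ => sq_nonneg _)] at key
  rw [ENNReal.ofReal_eq_ofReal_iff (integral_nonneg fun _ => sq_nonneg _)
    (mul_nonneg (integral_nonneg fun _ => Nat.cast_nonneg _) hb)] at key
  rw [key, mul_comm]

end RandomSums

/-! ### Fluctuations of branching processes with immigration -/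

section BranchingFluctuations

variable {Ω : Type*} [mΩ : MeasurableSpace Ω]

/-- The `σ`-algebra generated by the whole immigration and the offspring numbers of the first `k`
generations. -/
def branchingFiltration (ξ : ℕ+ → ℕ+ → Ω → ℕ) (ε : ℕ+ → Ω → ℕ) (hξ : ∀ k j, Measurable (ξ k j))
    (hε : ∀ k, Measurable (ε k)) : Filtration ℕ mΩ where
  seq k := (⨆ p ∈ {p : ℕ+ × ℕ+ | (p.1 : ℕ) ≤ k}, MeasurableSpace.comap (ξ p.1 p.2) inferInstance) ⊔
    ⨆ i, MeasurableSpace.comap (ε i) inferInstance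
  mono' _ _ hkl := sup_le_sup_right (biSup_mono fun _ hp => le_trans hp hkl) _
  le' _ := sup_le (iSup₂_le fun _ _ => (hξ _ _).comap_le) (iSup_le fun _ => (hε _).comap_le)

/-- The `σ`-algebra generated by the offspring numbers in step `k + 1`. -/
abbrev offspringSigma (ξ : ℕ+ → ℕ+ → Ω → ℕ) (k : ℕ) : MeasurableSpace Ω :=
  ⨆ p ∈ {p : ℕ+ × ℕ+ | (p.1 : ℕ) = k + 1}, MeasurableSpace.comap (ξ p.1 p.2) inferInstance

/-- The centered reproduction in step `k + 1`, for offspring mean `c`. -/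
def branchingNoise (ξ : ℕ+ → ℕ+ → Ω → ℕ) (ε : ℕ+ → Ω → ℕ) (c : ℝ) (k : ℕ) (ω : Ω) : ℝ :=
  ∑ j ∈ Finset.range (branchingProcess ξ ε k ω), ((ξ k.succPNat j.succPNat ω : ℝ) - c)

variable {ξ : ℕ+ → ℕ+ → Ω → ℕ} {ε : ℕ+ → Ω → ℕ}

omit mΩ in
theorem branchingProcess_succ_eq (c : ℝ) (k : ℕ) (ω : Ω) :
    (branchingProcess ξ ε (k + 1) ω : ℝ) = c * branchingProcess ξ ε k ω +
      branchingNoise ξ ε c k ω + ε k.succPNat ω := by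
  simp only [branchingProcess, branchingNoise, Finset.sum_sub_distrib]
  push_cast
  simp
  ring

omit mΩ in
-- Variation of constants for the affine recursion.
theorem branchingProcess_eq_sum {c : ℝ} (hc : c ≠ 0) (k : ℕ) (ω : Ω) :
    (branchingProcess ξ ε k ω : ℝ) =
      c ^ k * (∑ j ∈ Finset.range k, c⁻¹ ^ (j + 1) * branchingNoise ξ ε c j ω +
        ∑ j ∈ Finset.range k, c⁻¹ ^ (j + 1) * (ε j.succPNat ω : ℝ)) := by
  induction k with
  | zero => simp [branchingProcess]
  | succ k ih =>
    rw [branchingProcess_succ_eq c, ih, Finset.sum_range_succ, Finset.sum_range_succ]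
    have h : c ^ (k + 1) * c⁻¹ ^ (k + 1) = 1 := by
      rw [← mul_pow, mul_inv_cancel₀ hc, one_pow]
    linear_combination (branchingNoise ξ ε c k ω + (ε k.succPNat ω : ℝ)) * (-h)

omit mΩ in
theorem measurable_offspringSigma (k j : ℕ) :
    Measurable[offspringSigma ξ k] (ξ k.succPNat j.succPNat) := by
  refine Measurable.mono (comap_measurable (ξ k.succPNat j.succPNat)) ?_ le_rfl
  exact le_iSup₂_of_le (f := fun (p : ℕ+ × ℕ+) (_ : p ∈ {p : ℕ+ × ℕ+ | (p.1 : ℕ) = k + 1}) =>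
    MeasurableSpace.comap (ξ p.1 p.2) inferInstance) (k.succPNat, j.succPNat) (by simp) le_rfl

variable (hξ : ∀ k j, Measurable (ξ k j)) (hε : ∀ k, Measurable (ε k))

include hξ in
theorem offspringSigma_le (k : ℕ) : offspringSigma ξ k ≤ mΩ :=
  iSup₂_le fun _ _ => (hξ _ _).comap_le

theorem measurable_immigration_filtration (k : ℕ) (i : ℕ+) :
    Measurable[branchingFiltration ξ ε hξ hε k] (ε i) := by
  refine Measurable.mono (comap_measurable (ε i)) ?_ le_rfl
  exact le_trans (le_iSup (fun i => MeasurableSpace.comap (ε i) inferInstance) i) le_sup_right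

theorem offspringSigma_le_filtration (k : ℕ) :
    offspringSigma ξ k ≤ branchingFiltration ξ ε hξ hε (k + 1) :=
  le_trans (biSup_mono fun _ hp => le_of_eq hp) le_sup_left

theorem measurable_branchingProcess_filtration (k : ℕ) :
    Measurable[branchingFiltration ξ ε hξ hε k] (branchingProcess ξ ε k) := by
  induction k with
  | zero => exact measurable_const
  | succ k ih =>
    refine Measurable.add (measurable_sum_range_random
      (ih.mono ((branchingFiltration ξ ε hξ hε).mono k.le_succ) le_rfl) fun j => ?_)
      (measurable_immigration_filtration hξ hε (k + 1) k.succPNat)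
    exact (measurable_offspringSigma k j).mono (offspringSigma_le_filtration hξ hε k) le_rfl

theorem measurable_branchingNoise_filtration (c : ℝ) (k : ℕ) :
    Measurable[branchingFiltration ξ ε hξ hε (k + 1)] (branchingNoise ξ ε c k) := by
  refine measurable_sum_range_random ((measurable_branchingProcess_filtration hξ hε k).mono
      ((branchingFiltration ξ ε hξ hε).mono k.le_succ) le_rfl) fun j => ?_
  have h := (measurable_offspringSigma (ξ := ξ) k j).mono
    (offspringSigma_le_filtration hξ hε k) le_rfl
  exact ((measurable_of_countable fun x : ℕ => (x : ℝ)).comp h).sub_const c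

variable {P : Measure Ω} [IsProbabilityMeasure P]
  (hindep : iIndepFun (fun p : ℕ+ × ℕ+ => ξ p.1 p.2) P)
  (hξε : IndepFun (fun ω (p : ℕ+ × ℕ+) => ξ p.1 p.2 ω) (fun ω k => ε k ω) P)

include hindep hξε in
-- Offspring of different generations come from disjoint blocks of an independent family, and the
-- immigration is independent of all offspring. So it may be revealed in advance, and its internal
-- dependence does not affect the martingale structure of the noise.
theorem indep_filtration_offspringSigma (k : ℕ) :
    Indep (branchingFiltration ξ ε hξ hε k) (offspringSigma ξ k) P := by
  have h12 : Indep (⨆ p ∈ {p : ℕ+ × ℕ+ | (p.1 : ℕ) ≤ k},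
      MeasurableSpace.comap (ξ p.1 p.2) inferInstance) (offspringSigma ξ k) P := by
    have h := indep_iSup_of_disjoint
      (m := fun p : ℕ+ × ℕ+ => MeasurableSpace.comap (ξ p.1 p.2) inferInstance)
      (S := {p : ℕ+ × ℕ+ | (p.1 : ℕ) ≤ k}) (T := {p : ℕ+ × ℕ+ | (p.1 : ℕ) = k + 1})
      (fun p => (hξ p.1 p.2).comap_le) hindep.iIndep
    refine h ?_
    rw [Set.disjoint_left]
    intro p (hp : (p.1 : ℕ) ≤ k) (hp' : (p.1 : ℕ) = k + 1)
    omega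
  refine h12.sup_left_of_sup_left (iSup₂_le fun _ _ => (hξ _ _).comap_le)
    (offspringSigma_le hξ k) (iSup_le fun _ => (hε _).comap_le) ?_
  rw [IndepFun_iff_Indep] at hξε
  refine indep_of_indep_of_le hξε (sup_le ?_ ?_) ?_
  · exact iSup₂_le fun p _ => Measurable.comap_le
      ((measurable_pi_apply p).comp (comap_measurable fun ω (p : ℕ+ × ℕ+) => ξ p.1 p.2 ω))
  · exact iSup₂_le fun p _ => Measurable.comap_le
      ((measurable_pi_apply p).comp (comap_measurable fun ω (p : ℕ+ × ℕ+) => ξ p.1 p.2 ω))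
  · exact iSup_le fun i => Measurable.comap_le
      ((measurable_pi_apply i).comp (comap_measurable fun ω k => ε k ω))

variable (hident : ∀ k j, IdentDistrib (ξ k j) (ξ 1 1) P P)
  (hL2 : MemLp (fun ω => (ξ 1 1 ω : ℝ)) 2 P) (hεint : ∀ k, Integrable (fun ω => (ε k ω : ℝ)) P)
  {c b : ℝ} (hc : ∫ ω, (ξ 1 1 ω : ℝ) ∂P = c) (hb : variance (fun ω => (ξ 1 1 ω : ℝ)) P = b)

omit [IsProbabilityMeasure P] in
include hident in
theorem identDistrib_offspring_cast (k j : ℕ+) :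
    IdentDistrib (fun ω => (ξ k j ω : ℝ)) (fun ω => (ξ 1 1 ω : ℝ)) P P :=
  (hident k j).comp (measurable_of_countable fun x : ℕ => (x : ℝ))

include hident hL2 in
theorem memLp_centered_offspring (c : ℝ) (k j : ℕ+) : MemLp (fun ω => (ξ k j ω : ℝ) - c) 2 P :=
  ((identDistrib_offspring_cast hident k j).memLp_iff.mpr hL2).sub (memLp_const c)

include hident hL2 hc in
theorem integral_centered_offspring (k j : ℕ+) : ∫ ω, ((ξ k j ω : ℝ) - c) ∂P = 0 := by
  have h := identDistrib_offspring_cast hident k j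
  rw [integral_sub ((h.memLp_iff.mpr hL2).integrable one_le_two) (integrable_const _),
    h.integral_eq, hc]
  simp

include hξ hε hindep hξε hident hL2 hc in
theorem integral_mul_branchingNoise (k : ℕ) {G : Ω → ℝ}
    (hG : Measurable[branchingFiltration ξ ε hξ hε k] G)
    (hint : Integrable (fun ω => G ω * branchingNoise ξ ε c k ω) P) :
    ∫ ω, G ω * branchingNoise ξ ε c k ω ∂P = 0 :=
  integral_mul_random_sum_eq_zero ((branchingFiltration ξ ε hξ hε).le k) (offspringSigma_le hξ k)
    (indep_filtration_offspringSigma hξ hε hindep hξε k)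
    (measurable_branchingProcess_filtration hξ hε k)
    (fun j => ((measurable_of_countable fun x : ℕ => (x : ℝ)).comp
      (measurable_offspringSigma k j)).sub_const c)
    (fun _ => (memLp_centered_offspring hident hL2 c _ _).integrable one_le_two)
    (fun _ => integral_centered_offspring hident hL2 hc _ _) hG hint

include hξ hε hindep hξε hident hL2 hc hb in
theorem memLp_branchingNoise_of_integrable (k : ℕ)
    (hX : Integrable (fun ω => (branchingProcess ξ ε k ω : ℝ)) P) :
    MemLp (branchingNoise ξ ε c k) 2 P ∧ ∫ ω, branchingNoise ξ ε c k ω ^ 2 ∂P =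
      b * ∫ ω, (branchingProcess ξ ε k ω : ℝ) ∂P := by
  refine memLp_random_sum ((branchingFiltration ξ ε hξ hε).le k) (offspringSigma_le hξ k)
    (indep_filtration_offspringSigma hξ hε hindep hξε k)
    (measurable_branchingProcess_filtration hξ hε k) hX
    (fun j => ((measurable_of_countable fun x : ℕ => (x : ℝ)).comp
      (measurable_offspringSigma k j)).sub_const c)
    (fun _ => memLp_centered_offspring hident hL2 c _ _)
    (fun _ => integral_centered_offspring hident hL2 hc _ _) (fun j => ?_) (fun i j hij => ?_)
  · have h := identDistrib_offspring_cast hident k.succPNat j.succPNat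
    change variance (fun ω => (ξ k.succPNat j.succPNat ω : ℝ) - c) P = b
    rw [variance_sub_const (h.memLp_iff.mpr hL2).aestronglyMeasurable, h.variance_eq, hb]
  · have h := hindep.indepFun (i := (k.succPNat, i.succPNat)) (j := (k.succPNat, j.succPNat))
      (by simpa using hij)
    exact h.comp (measurable_of_countable fun x : ℕ => (x : ℝ) - c)
      (measurable_of_countable fun x : ℕ => (x : ℝ) - c)

include hξ hε hindep hξε hident hL2 hεint hc hb in
-- A first moment of `X k` puts the noise in `L²`, which gives a first moment of `X (k + 1)`; no
-- second moment of the process enters.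
theorem integrable_branchingProcess (k : ℕ) :
    Integrable (fun ω => (branchingProcess ξ ε k ω : ℝ)) P := by
  induction k with
  | zero => simp [branchingProcess]
  | succ k ih =>
    simp_rw [branchingProcess_succ_eq c]
    have h := (memLp_branchingNoise_of_integrable hξ hε hindep hξε hident hL2 hc hb k ih).1
    exact ((ih.const_mul c).add (h.integrable one_le_two)).add (hεint _)

include hξ hε hindep hξε hident hL2 hεint hc hb in
theorem memLp_branchingNoise (k : ℕ) :
    MemLp (branchingNoise ξ ε c k) 2 P ∧ ∫ ω, branchingNoise ξ ε c k ω ^ 2 ∂P =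
      b * ∫ ω, (branchingProcess ξ ε k ω : ℝ) ∂P :=
  memLp_branchingNoise_of_integrable hξ hε hindep hξε hident hL2 hc hb k
    (integrable_branchingProcess hξ hε hindep hξε hident hL2 hεint hc hb k)

include hξ hε hindep hξε hident hL2 hεint hc hb in
theorem integral_branchingProcess_eq_sum (hc0 : c ≠ 0) (k : ℕ) :
    ∫ ω, (branchingProcess ξ ε k ω : ℝ) ∂P =
      c ^ k * ∑ j ∈ Finset.range k, c⁻¹ ^ (j + 1) * ∫ ω, (ε j.succPNat ω : ℝ) ∂P := by
  have hD := fun k => ((memLp_branchingNoise hξ hε hindep hξε hident hL2 hεint hc hb k).1).integrable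
    one_le_two
  have hD0 : ∀ k, ∫ ω, branchingNoise ξ ε c k ω ∂P = 0 := by
    intro k
    have h := integral_mul_branchingNoise hξ hε hindep hξε hident hL2 hc k (G := fun _ => 1)
      measurable_const (by simpa using hD k)
    simpa using h
  simp_rw [branchingProcess_eq_sum hc0]
  rw [integral_const_mul, integral_add (integrable_finsetSum _ fun j _ => (hD j).const_mul _)
    (integrable_finsetSum _ fun j _ => (hεint _).const_mul _),
    integral_finsetSum _ fun j _ => (hD j).const_mul _,
    integral_finsetSum _ fun j _ => (hεint _).const_mul _]
  simp [integral_const_mul, hD0]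

include hξ hε hindep hξε hident hL2 hεint hc hb in
/-- Kolmogorov's inequality for the weighted sums of the noise. -/
theorem measure_exists_sum_branchingNoise_ge (w : ℕ → ℝ) {r : ℝ} (hr : 0 < r) (n : ℕ) :
    P {ω | ∃ k ≤ n, r ≤ |∑ j ∈ Finset.range k, w j * branchingNoise ξ ε c j ω|} ≤
      ENNReal.ofReal ((∑ j ∈ Finset.range n,
        w j ^ 2 * (b * ∫ ω, (branchingProcess ξ ε j ω : ℝ) ∂P)) / r ^ 2) := by
  set 𝒢 := branchingFiltration ξ ε hξ hε
  set D := branchingNoise ξ ε c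
  set S : ℕ → Ω → ℝ := fun k ω => ∑ j ∈ Finset.range k, w j * D j ω with hS
  have hD2 := memLp_branchingNoise hξ hε hindep hξε hident hL2 hεint hc hb
  have hSm : ∀ k, Measurable[𝒢 k] (S k) := fun k =>
    Finset.measurable_fun_sum _ fun j hj =>
      ((measurable_branchingNoise_filtration hξ hε c j).mono
        (𝒢.mono (Finset.mem_range.mp hj)) le_rfl).const_mul _
  have hS2 : ∀ k, MemLp (S k) 2 P := fun k =>
    memLp_finsetSum _ fun j _ => (hD2 j).1.const_mul _
  have hsucc : ∀ k ω, S (k + 1) ω ^ 2 = S k ω ^ 2 + 2 * w k * (S k ω * D k ω) +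
      w k ^ 2 * D k ω ^ 2 := by
    intro k ω
    simp only [hS, Finset.sum_range_succ]
    ring
  have hSD : ∀ k, Integrable (fun ω => S k ω * D k ω) P := fun k =>
    (hS2 k).integrable_mul (hD2 k).1
  -- The cross term vanishes because `1_s * S k` is known at time `k`. This makes `S²` a
  -- submartingale, so Doob's maximal inequality applies, and with `s = univ` it computes the second
  -- moment.
  have hset : ∀ k s, MeasurableSet[𝒢 k] s → ∫ ω in s, S (k + 1) ω ^ 2 ∂P =
      ∫ ω in s, S k ω ^ 2 ∂P + w k ^ 2 * ∫ ω in s, D k ω ^ 2 ∂P := by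
    intro k s hs
    simp_rw [hsucc]
    have i1 : Integrable (fun ω => S k ω ^ 2) (P.restrict s) := (hS2 k).integrable_sq.restrict
    have i2 : Integrable (fun ω => 2 * w k * (S k ω * D k ω)) (P.restrict s) :=
      ((hSD k).const_mul _).restrict
    have i3 : Integrable (fun ω => w k ^ 2 * D k ω ^ 2) (P.restrict s) :=
      ((hD2 k).1.integrable_sq.const_mul _).restrict
    have hzero : ∫ ω in s, S k ω * D k ω ∂P = 0 := by
      rw [← integral_indicator (𝒢.le k s hs)]
      have e : s.indicator (fun ω => S k ω * D k ω) = fun ω => s.indicator (S k) ω * D k ω := by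
        funext ω
        by_cases h : ω ∈ s <;> simp [h]
      rw [e]
      refine integral_mul_branchingNoise hξ hε hindep hξε hident hL2 hc k
        (Measurable.indicator (hSm k) hs) ?_
      rw [← e]
      exact (hSD k).indicator (𝒢.le k s hs)
    rw [integral_add (f := fun ω => S k ω ^ 2 + 2 * w k * (S k ω * D k ω)) (i1.add i2) i3,
      integral_add i1 i2, integral_const_mul, integral_const_mul,
      hzero, mul_zero, add_zero]
  have hsub : Submartingale (fun k ω => S k ω ^ 2) 𝒢 P := by
    refine submartingale_of_setIntegral_le_succ
      (fun k => ((hSm k).pow_const 2).stronglyMeasurable) (fun k => (hS2 k).integrable_sq) ?_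
    intro k s hs
    rw [hset k s hs]
    have : 0 ≤ ∫ ω in s, D k ω ^ 2 ∂P := integral_nonneg fun _ => sq_nonneg _
    nlinarith [mul_nonneg (sq_nonneg (w k)) this]
  have hval : ∀ k, ∫ ω, S k ω ^ 2 ∂P =
      ∑ j ∈ Finset.range k, w j ^ 2 * (b * ∫ ω, (branchingProcess ξ ε j ω : ℝ) ∂P) := by
    intro k
    induction k with
    | zero => simp [hS]
    | succ k ih =>
      have h := hset k Set.univ MeasurableSet.univ
      simp only [setIntegral_univ] at h
      rw [h, ih, Finset.sum_range_succ, (hD2 k).2]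
  have hmax := maximal_ineq hsub (fun k ω => sq_nonneg _) (ε := (r ^ 2).toNNReal) n
  have hr2 : ((r ^ 2).toNNReal : ℝ) = r ^ 2 := Real.coe_toNNReal _ (sq_nonneg r)
  rw [hr2] at hmax
  have hsubset : {ω | ∃ k ≤ n, r ≤ |S k ω|} ⊆ {ω | r ^ 2 ≤
      (Finset.range (n + 1)).sup' Finset.nonempty_range_add_one fun k => S k ω ^ 2} := by
    rintro ω ⟨k, hk, hrk⟩
    have h1 : r ^ 2 ≤ S k ω ^ 2 := by
      rw [← sq_abs (S k ω)]
      gcongr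
    exact h1.trans (Finset.le_sup' (fun k => S k ω ^ 2) (Finset.mem_range.mpr (by omega)))
  rw [← hval, ENNReal.ofReal_div_of_pos (by positivity)]
  rw [ENNReal.le_div_iff_mul_le (Or.inl (by positivity)) (Or.inl ENNReal.ofReal_ne_top), mul_comm]
  refine (mul_le_mul_right (measure_mono hsubset) _).trans (hmax.trans ?_)
  exact ENNReal.ofReal_le_ofReal (setIntegral_le_integral (hS2 n).integrable_sq
    (ae_of_all _ fun _ => sq_nonneg _))

end BranchingFluctuations

/-! ### Random paths -/

theorem NNReal.floor_eq_floor_coe (x : ℝ≥0) : ⌊x⌋₊ = ⌊(x : ℝ)⌋₊ := by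
  symm
  rw [Nat.floor_eq_iff x.coe_nonneg]
  exact ⟨by exact_mod_cast Nat.floor_le (zero_le (a := x)),
    by exact_mod_cast Nat.lt_floor_add_one x⟩

/-- On `[0, 1/δ]` a step path depends on finitely many coordinates, so a product neighbourhood
suffices, with identity time change. Continuity is what makes the normalized paths measurable. -/
theorem continuous_stepPath (n : ℕ+) : Continuous (stepPath n) := by
  refine ⟨fun U hU => isOpen_iff_mem_nhds.mpr fun x hx => ?_⟩
  obtain ⟨δ, hδ, hsub⟩ := hU _ hx
  have h : ∀ᶠ y : ℕ → ℝ in 𝓝 x, ∀ k ∈ Finset.range (⌊(n : ℝ) * (1 / δ)⌋₊ + 1),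
      |y k - x k| ≤ δ := by
    refine (Finset.eventually_all _).mpr fun k _ => ?_
    have hc : Tendsto (fun y : ℕ → ℝ => |y k - x k|) (𝓝 x) (𝓝 |x k - x k|) :=
      (((continuous_apply k).sub continuous_const).abs).tendsto x
    rw [sub_self, abs_zero] at hc
    exact (hc.eventually (gt_mem_nhds hδ)).mono fun _ h => h.le
  filter_upwards [h] with y hy
  refine hsub ⟨OrderIso.refl _, fun s => by simpa using hδ.le, fun s hs => hy _ ?_⟩
  rw [Finset.mem_range, Nat.lt_succ_iff, NNReal.floor_eq_floor_coe]
  refine Nat.floor_le_floor ?_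
  push_cast
  exact mul_le_mul_of_nonneg_left hs (Nat.cast_nonneg _)

theorem measurable_stepPath (n : ℕ+) : Measurable (stepPath n) :=
  (continuous_stepPath n).measurable

/-- For bounded continuous `f`, the open set where `f` is within `η / 2` of `f x` contains some
`x.nearby δ`; off it the difference is at most `2 ‖f‖`, on an event of vanishing probability. -/
theorem tendstoInDistribution_const_of_tendsto_measure {ι Ω : Type*} [MeasurableSpace Ω]
    {P : Measure Ω} [IsProbabilityMeasure P] {l : Filter ι} {X : ι → Ω → SkorokhodSpace}
    {x : SkorokhodSpace} (hX : ∀ i, AEMeasurable (X i) P)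
    (h : ∀ δ : ℝ, 0 < δ → Tendsto (fun i => P {ω | X i ω ∉ x.nearby δ}) l (𝓝 0)) :
    TendstoInDistribution X l (fun _ : Ω => x) (fun _ => P) P := by
  refine ⟨hX, aemeasurable_const, ?_⟩
  refine ProbabilityMeasure.tendsto_iff_forall_integral_tendsto.mpr ?_
  intro f
  have hfm : Measurable f := f.continuous.measurable
  simp only [ProbabilityMeasure.coe_mk]
  have e : ∀ i, ∫ y, f y ∂(P.map (X i)) = ∫ ω, f (X i ω) ∂P := fun i =>
    integral_map (hX i) hfm.aestronglyMeasurable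
  simp_rw [e]
  rw [integral_map aemeasurable_const hfm.aestronglyMeasurable]
  have hint : ∀ i, Integrable (fun ω => f (X i ω)) P := fun i =>
    Integrable.of_bound (hfm.comp_aemeasurable (hX i)).aestronglyMeasurable ‖f‖
      (ae_of_all _ fun ω => f.norm_coe_le_norm _)
  simp only [integral_const, probReal_univ, one_smul]
  rw [Metric.tendsto_nhds]
  intro η hη
  have hU : IsOpen {y | |f y - f x| < η / 2} :=
    isOpen_lt (by fun_prop) continuous_const
  obtain ⟨δ, hδ, hsub⟩ := hU x (by simpa using hη)
  have hM : 0 < 2 * ‖f‖ + 1 := by positivity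
  have hev := (h δ hδ).eventually (gt_mem_nhds (show (0 : ℝ≥0∞) <
    ENNReal.ofReal (η / (2 * (2 * ‖f‖ + 1))) by rw [ENNReal.ofReal_pos]; positivity))
  filter_upwards [hev] with i hi
  -- The measurable hull has the same measure, so measurability of `nearby` is not needed.
  set bad : Set Ω := toMeasurable P {ω | X i ω ∉ x.nearby δ} with hbad
  have hbm : MeasurableSet bad := measurableSet_toMeasurable _ _
  have hreal : P.real bad < η / (2 * (2 * ‖f‖ + 1)) := by
    rw [measureReal_def, hbad, measure_toMeasurable]
    exact ENNReal.toReal_lt_of_lt_ofReal hi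
  have hle : ∀ ω, |f (X i ω) - f x| ≤ η / 2 + bad.indicator (fun _ => 2 * ‖f‖) ω := by
    intro ω
    by_cases hω : X i ω ∈ x.nearby δ
    · have h1 : |f (X i ω) - f x| < η / 2 := hsub hω
      have h2 : 0 ≤ bad.indicator (fun _ => 2 * ‖f‖) ω :=
        Set.indicator_nonneg (fun _ _ => by positivity) _
      linarith
    · rw [Set.indicator_of_mem (subset_toMeasurable _ _ hω)]
      have h1 := f.norm_coe_le_norm (X i ω)
      have h2 := f.norm_coe_le_norm x
      have h3 := norm_sub_le (f (X i ω)) (f x)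
      rw [Real.norm_eq_abs (f (X i ω) - f x)] at h3
      linarith
  have hind : Integrable (bad.indicator fun _ => 2 * ‖f‖) P :=
    (integrable_const _).indicator hbm
  rw [Real.dist_eq]
  calc |∫ ω, f (X i ω) ∂P - f x| = |∫ ω, (f (X i ω) - f x) ∂P| := by
        rw [integral_sub (hint i) (integrable_const _)]; simp
    _ ≤ ∫ ω, |f (X i ω) - f x| ∂P := abs_integral_le_integral_abs
    _ ≤ ∫ ω, (η / 2 + bad.indicator (fun _ => 2 * ‖f‖) ω) ∂P :=
        integral_mono ((hint i).sub (integrable_const _)).abs ((integrable_const _).add hind) hle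
    _ = η / 2 + P.real bad * (2 * ‖f‖) := by
        rw [integral_add (integrable_const _) hind, integral_indicator_const _ hbm]
        simp
    _ < η := by
        have h1 : P.real bad * (2 * ‖f‖ + 1) < η / 2 := by
          rw [lt_div_iff₀ (by positivity)] at hreal
          linarith
        nlinarith [measureReal_nonneg (μ := P) (s := bad)]

/-- Monotone functions that are close to a continuous function on a suitable finite set are
uniformly close to it. -/
theorem exists_finset_abs_sub_le_of_monotoneOn {ν : ℝ → ℝ} (hν : Continuous ν) (T : ℝ) {η : ℝ}
    (hη : 0 < η) : ∃ G : Finset ℝ, (∀ t ∈ G, 0 ≤ t) ∧ ∀ f : ℝ → ℝ, MonotoneOn f (Set.Ici 0) →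
      (∀ t ∈ G, |f t - ν t| ≤ η) → ∀ t ∈ Set.Icc 0 T, |f t - ν t| ≤ 2 * η := by
  have huc := (isCompact_Icc (a := (0 : ℝ)) (b := T + 1)).uniformContinuousOn_of_continuous
    hν.continuousOn
  rw [Metric.uniformContinuousOn_iff] at huc
  obtain ⟨d, hd, hdist⟩ := huc η hη
  -- Mesh below the modulus `d`, and at most 1 so that the grid point to the right of `t ≤ T` stays
  -- in `[0, T + 1]`.
  set r := min (d / 2) 1
  have hr : 0 < r := by positivity
  have hrd : r < d := (min_le_left _ _).trans_lt (by linarith)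
  have hr1 : r ≤ 1 := min_le_right _ _
  refine ⟨(Finset.range (⌊T / r⌋₊ + 2)).image fun i : ℕ => (i : ℝ) * r, ?_, ?_⟩
  · intro t ht
    obtain ⟨i, -, rfl⟩ := Finset.mem_image.mp ht
    positivity
  intro f hf hG t ht
  have htr : 0 ≤ t / r := div_nonneg ht.1 hr.le
  have hi : ⌊t / r⌋₊ ≤ ⌊T / r⌋₊ := Nat.floor_le_floor (by gcongr; exact ht.2)
  have h1 : (⌊t / r⌋₊ : ℝ) * r ≤ t := by
    rw [← le_div_iff₀ hr]; exact Nat.floor_le htr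
  have h2 : t ≤ ((⌊t / r⌋₊ + 1 : ℕ) : ℝ) * r := by
    rw [← div_le_iff₀ hr]; push_cast; exact (Nat.lt_floor_add_one _).le
  have g1 := hG _ (Finset.mem_image.mpr ⟨⌊t / r⌋₊, Finset.mem_range.mpr (by omega), rfl⟩)
  have g2 := hG _ (Finset.mem_image.mpr ⟨⌊t / r⌋₊ + 1, Finset.mem_range.mpr (by omega), rfl⟩)
  set p := (⌊t / r⌋₊ : ℝ) * r with hp
  set q := ((⌊t / r⌋₊ + 1 : ℕ) : ℝ) * r with hq
  have hpq : q = p + r := by rw [hp, hq]; push_cast; ring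
  have hp0 : 0 ≤ p := by positivity
  have ht0 := ht.1
  have htT := ht.2
  have f1 := hf (Set.mem_Ici.mpr hp0) (Set.mem_Ici.mpr ht0) h1
  have f2 := hf (Set.mem_Ici.mpr ht0) (Set.mem_Ici.mpr (ht0.trans h2)) h2
  have n1 := hdist t ⟨ht0, by linarith⟩ p ⟨hp0, by linarith⟩ (by
    rw [Real.dist_eq, abs_lt]; constructor <;> linarith)
  have n2 := hdist t ⟨ht0, by linarith⟩ q ⟨by linarith, by linarith⟩ (by
    rw [Real.dist_eq, abs_lt]; constructor <;> linarith)
  rw [Real.dist_eq, abs_lt] at n1 n2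
  rw [abs_le] at g1 g2 ⊢
  constructor <;> linarith

/-! ### The limit function -/

/-- `ν(t) = ∫_0^t u^α e^{-a u} du`, so that `μ_α(t) = e^{a t} ν(t)`. -/
def discountedMu (a α t : ℝ) : ℝ := ∫ u in (0 : ℝ)..t, u ^ α * Real.exp (-(a * u))

theorem muFun_eq_exp_mul (a α t : ℝ) : muFun a α t = Real.exp (a * t) * discountedMu a α t := by
  rw [muFun, discountedMu, ← intervalIntegral.integral_const_mul]
  congr 1
  funext u
  rw [mul_sub, sub_eq_add_neg, Real.exp_add]
  ring

theorem continuous_discountedMu (a : ℝ) {α : ℝ} (hα : 0 ≤ α) : Continuous (discountedMu a α) := by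
  have h : discountedMu a α = fun t => Real.exp (-(a * t)) * muFun a α t := by
    funext t
    rw [muFun_eq_exp_mul, ← mul_assoc, ← Real.exp_add]
    simp
  rw [h]
  exact (by fun_prop : Continuous fun t : ℝ => Real.exp (-(a * t))).mul (continuous_muFun a hα)

theorem discountedMu_pos (a : ℝ) {α t : ℝ} (hα : 0 ≤ α) (ht : 0 < t) : 0 < discountedMu a α t := by
  refine intervalIntegral.intervalIntegral_pos_of_pos_on ?_ (fun u hu => ?_) ht
  · exact ((Real.continuous_rpow_const hα).mul (by fun_prop)).intervalIntegrable _ _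
  · exact mul_pos (Real.rpow_pos_of_pos hu.1 _) (Real.exp_pos _)

/-! ### Asymptotics of the immigration and the noise -/

section Asymptotics

variable {Ω : Type*} [MeasurableSpace Ω] {P : Measure Ω} [IsProbabilityMeasure P]
  {ε : ℕ+ → ℕ+ → Ω → ℕ} {a α β : ℝ} {αseq βseq : ℕ+ → ℝ} {c : ℕ+ → ℝ}

/-- Chebyshev's inequality: the normalized mean converges to `ν(t)`, and the variance is `O(n
β(n))`, which is `o((n α(n))²)`. -/
theorem tendsto_measure_discounted_immigration
    (hε_meas : ∀ n k, Measurable (ε n k))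
    (hε_L2 : ∀ n k, MemLp (fun ω => (ε n k ω : ℝ)) 2 P)
    (hmix_sum : (⨆ n : ℕ+, ∑' k : ℕ+, psiMixingCoeff P (ε n) k) < ∞)
    (hα : 0 ≤ α) (hβ : 0 ≤ β) (hαseq : IsRegularlyVaryingSeq α αseq)
    (hβseq : IsRegularlyVaryingSeq β βseq)
    (hmean : RowsApproximate (fun n k => ∫ ω, (ε n k ω : ℝ) ∂P) αseq)
    (hvar : RowsApproximate (fun n k => variance (fun ω => (ε n k ω : ℝ)) P) βseq)
    (hβ_small : βseq =o[atTop] fun n : ℕ+ => (n : ℝ) * αseq n ^ 2)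
    (hpos : ∀ᶠ n in atTop, 0 < c n)
    (hlog : Tendsto (fun n : ℕ+ => (n : ℝ) * Real.log (c n)) atTop (𝓝 a))
    {t : ℝ} (ht : 0 ≤ t) {η : ℝ} (hη : 0 < η) :
    Tendsto (fun n : ℕ+ => P {ω | η ≤ |(∑ j ∈ Finset.range ⌊(n : ℝ) * t⌋₊,
      (c n)⁻¹ ^ (j + 1) * (ε n j.succPNat ω : ℝ)) / (n * αseq n) - discountedMu a α t|})
      atTop (𝓝 0) := by
  set V : ℕ+ → Ω → ℝ := fun n ω => ∑ j ∈ Finset.range ⌊(n : ℝ) * t⌋₊,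
      (c n)⁻¹ ^ (j + 1) * (ε n j.succPNat ω : ℝ) with hV
  set B : ℕ+ → ℝ := fun n => n * αseq n with hB
  have hBpos : ∀ n, 0 < B n := fun n => mul_pos n.cast_real_pos (hαseq.pos n)
  set Ψ := ⨆ n : ℕ+, ∑' k : ℕ+, psiMixingCoeff P (ε n) k
  have hV2 : ∀ n, MemLp (V n) 2 P := fun n =>
    memLp_finsetSum _ fun j _ => (hε_L2 n _).const_mul _
  have hmeanV : Tendsto (fun n => (∫ ω, V n ω ∂P) / B n) atTop (𝓝 (discountedMu a α t)) := by
    refine (hmean.tendsto_weighted_sum hαseq hα hpos hlog ht).congr fun n => ?_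
    rw [hV, integral_finsetSum _ fun j _ => ((hε_L2 n _).integrable one_le_two).const_mul _]
    simp [integral_const_mul, hB]
  obtain ⟨K, hK0, hK⟩ := exists_pow_le_of_tendsto_mul_log hpos hlog t
  -- The weighted-sum asymptotics with trivial weights, that is `c = 1` and `a = 0`.
  have hsumvar : Tendsto (fun n : ℕ+ => (∑ j ∈ Finset.range ⌊(n : ℝ) * t⌋₊,
      variance (fun ω => (ε n j.succPNat ω : ℝ)) P) / (n * βseq n)) atTop
      (𝓝 (∫ u in (0 : ℝ)..t, u ^ β * Real.exp (-(0 * u)))) := by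
    refine (hvar.tendsto_weighted_sum hβseq hβ (c := fun _ => 1) (a := 0)
      (Eventually.of_forall fun _ => one_pos) (by simp) ht).congr fun n => ?_
    simp
  have hsmall := hβ_small.tendsto_div_nhds_zero
  have hbound : Tendsto (fun n : ℕ+ => K ^ 2 * (1 + 2 * Ψ.toReal) *
      ((∑ j ∈ Finset.range ⌊(n : ℝ) * t⌋₊,
      variance (fun ω => (ε n j.succPNat ω : ℝ)) P) / (n * βseq n)) *
      (βseq n / (n * αseq n ^ 2)) / (η / 2) ^ 2) atTop (𝓝 0) := by
    have h := (((hsumvar.const_mul (K ^ 2 * (1 + 2 * Ψ.toReal))).mul hsmall).div_const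
      ((η / 2) ^ 2))
    simpa using h
  have hbound' := ENNReal.tendsto_ofReal hbound
  rw [ENNReal.ofReal_zero] at hbound'
  refine tendsto_of_tendsto_of_tendsto_of_le_of_le' tendsto_const_nhds hbound'
    (Eventually.of_forall fun _ => zero_le) ?_
  have hclose := Metric.tendsto_nhds.mp hmeanV (η / 2) (by positivity)
  filter_upwards [hclose, hK, hpos] with n hn hKn hcn
  have hBn := hBpos n
  have hn0 := n.cast_real_pos
  have hβn := hβseq.pos n
  have hαn := hαseq.pos n
  have hsub : {ω | η ≤ |V n ω / B n - discountedMu a α t|} ⊆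
      {ω | η / 2 * B n ≤ |V n ω - ∫ ω, V n ω ∂P|} := by
    intro ω (hω : η ≤ |V n ω / B n - discountedMu a α t|)
    rw [Real.dist_eq] at hn
    have h1 := abs_sub_le (V n ω / B n) ((∫ ω, V n ω ∂P) / B n) (discountedMu a α t)
    have h2 : |V n ω / B n - (∫ ω, V n ω ∂P) / B n| = |V n ω - ∫ ω, V n ω ∂P| / B n := by
      rw [← sub_div, abs_div, abs_of_pos hBn]
    change η / 2 * B n ≤ |V n ω - ∫ ω, V n ω ∂P|
    rw [← le_div_iff₀ hBn, ← h2]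
    linarith
  refine (measure_mono hsub).trans ((meas_ge_le_variance_div_sq (hV2 n) (by positivity)).trans
    (ENNReal.ofReal_le_ofReal ?_))
  have hvarV : variance (V n) P ≤ K ^ 2 * (1 + 2 * Ψ.toReal) *
      ∑ j ∈ Finset.range ⌊(n : ℝ) * t⌋₊, variance (fun ω => (ε n j.succPNat ω : ℝ)) P := by
    refine variance_sum_le_of_psiMixing (hε_meas n) (hε_L2 n) hmix_sum.ne
      (le_iSup (fun n : ℕ+ => ∑' k : ℕ+, psiMixingCoeff P (ε n) k) n) _ fun j hj => ?_
    have hinv := inv_pos.mpr hcn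
    rw [abs_of_pos (by positivity)]
    refine (hKn (j + 1) ?_).2
    exact le_trans (by exact_mod_cast hj) (Nat.floor_le (mul_nonneg hn0.le ht))
  calc variance (V n) P / (η / 2 * B n) ^ 2 ≤ _ := div_le_div_of_nonneg_right hvarV (by positivity)
    _ = _ := by
      simp only [hB]
      field_simp

theorem tendsto_measure_branchingNoise {ξ : ℕ+ → ℕ+ → ℕ+ → Ω → ℕ} {b : ℕ+ → ℝ}
    (hξ_meas : ∀ n k j, Measurable (ξ n k j))
    (hε_meas : ∀ n k, Measurable (ε n k))
    (hξ_indep : ∀ n, iIndepFun (fun p : ℕ+ × ℕ+ => ξ n p.1 p.2) P)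
    (hξ_ident : ∀ n k j, IdentDistrib (ξ n k j) (ξ n 1 1) P P)
    (hξ_L2 : ∀ n, MemLp (fun ω => (ξ n 1 1 ω : ℝ)) 2 P)
    (hε_int : ∀ n k, Integrable (fun ω => (ε n k ω : ℝ)) P)
    (hξε : ∀ n, IndepFun (fun ω (p : ℕ+ × ℕ+) => ξ n p.1 p.2 ω) (fun ω k => ε n k ω) P)
    (hα : 0 ≤ α) (hαseq : IsRegularlyVaryingSeq α αseq)
    (hmean : RowsApproximate (fun n k => ∫ ω, (ε n k ω : ℝ) ∂P) αseq)
    (hc : ∀ n, ∫ ω, (ξ n 1 1 ω : ℝ) ∂P = c n)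
    (hb : ∀ n, variance (fun ω => (ξ n 1 1 ω : ℝ)) P = b n) (hb_small : b =o[atTop] αseq)
    (hpos : ∀ᶠ n in atTop, 0 < c n)
    (hlog : Tendsto (fun n : ℕ+ => (n : ℝ) * Real.log (c n)) atTop (𝓝 a))
    {T : ℝ} (hT : 0 ≤ T) {r : ℝ} (hr : 0 < r) :
    Tendsto (fun n : ℕ+ => P {ω | ∃ k ≤ ⌊(n : ℝ) * T⌋₊, r * (n * αseq n) ≤
      |∑ j ∈ Finset.range k, (c n)⁻¹ ^ (j + 1) * branchingNoise (ξ n) (ε n) (c n) j ω|})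
      atTop (𝓝 0) := by
  obtain ⟨K, hK0, hK⟩ := exists_pow_le_of_tendsto_mul_log hpos hlog T
  have hmeanV := hmean.tendsto_weighted_sum hαseq hα hpos hlog hT
  set E : ℕ+ → ℝ := fun n => (∑ j ∈ Finset.range ⌊(n : ℝ) * T⌋₊,
    (c n)⁻¹ ^ (j + 1) * ∫ ω, (ε n j.succPNat ω : ℝ) ∂P) / (n * αseq n) with hE
  -- In Kolmogorov's bound, `K²` comes from the squared weights, a further `K` from `c ^ j` in the
  -- mean of `X j`, and `T` from the at most `n T` summands.
  have hbound : Tendsto (fun n : ℕ+ => T * K ^ 3 / r ^ 2 * E n * (b n / αseq n)) atTop (𝓝 0) := by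
    have h := (hmeanV.const_mul (T * K ^ 3 / r ^ 2)).mul hb_small.tendsto_div_nhds_zero
    simpa using h
  have hbound' := ENNReal.tendsto_ofReal hbound
  rw [ENNReal.ofReal_zero] at hbound'
  refine tendsto_of_tendsto_of_tendsto_of_le_of_le' tendsto_const_nhds hbound'
    (Eventually.of_forall fun _ => zero_le) ?_
  filter_upwards [hK, hpos] with n hKn hcn
  have hn0 := n.cast_real_pos
  have hαn := hαseq.pos n
  have hbn : 0 ≤ b n := hb n ▸ variance_nonneg _ _
  have hinv := inv_pos.mpr hcn
  have hfl := Nat.floor_le (mul_nonneg hn0.le hT)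
  refine (measure_exists_sum_branchingNoise_ge (hξ_meas n) (hε_meas n) (hξ_indep n) (hξε n)
    (hξ_ident n) (hξ_L2 n) (hε_int n) (hc n) (hb n) _ (by positivity) _).trans
    (ENNReal.ofReal_le_ofReal ?_)
  have hεnn : ∀ j : ℕ, 0 ≤ ∫ ω, (ε n j.succPNat ω : ℝ) ∂P := fun j =>
    integral_nonneg fun _ => Nat.cast_nonneg _
  have hEB : ∑ j ∈ Finset.range ⌊(n : ℝ) * T⌋₊,
      (c n)⁻¹ ^ (j + 1) * ∫ ω, (ε n j.succPNat ω : ℝ) ∂P = E n * (n * αseq n) := by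
    simp only [hE]
    field_simp
  have hEn : 0 ≤ E n := by
    refine div_nonneg (Finset.sum_nonneg fun j _ => ?_) (by positivity)
    exact mul_nonneg (by positivity) (hεnn j)
  have hterm : ∀ j ∈ Finset.range ⌊(n : ℝ) * T⌋₊, ((c n)⁻¹ ^ (j + 1)) ^ 2 *
      (b n * ∫ ω, (branchingProcess (ξ n) (ε n) j ω : ℝ) ∂P) ≤
      K ^ 2 * (b n * (K * (E n * (n * αseq n)))) := by
    intro j hj
    rw [Finset.mem_range] at hj
    have h1 : ((j + 1 : ℕ) : ℝ) ≤ n * T := le_trans (by exact_mod_cast hj) hfl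
    have h2 : (j : ℝ) ≤ n * T := le_trans (by push_cast; linarith) h1
    have h3 : ∫ ω, (branchingProcess (ξ n) (ε n) j ω : ℝ) ∂P ≤ K * (E n * (n * αseq n)) := by
      rw [integral_branchingProcess_eq_sum (hξ_meas n) (hε_meas n) (hξ_indep n) (hξε n)
        (hξ_ident n) (hξ_L2 n) (hε_int n) (hc n) (hb n) hcn.ne', ← hEB]
      refine mul_le_mul (hKn j h2).1 ?_ (Finset.sum_nonneg fun i _ => ?_) hK0.le
      · refine Finset.sum_le_sum_of_subset_of_nonneg ?_ fun i _ _ => ?_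
        · exact Finset.range_subset_range.mpr hj.le
        · exact mul_nonneg (by positivity) (hεnn i)
      · exact mul_nonneg (by positivity) (hεnn i)
    have h4 : 0 ≤ ∫ ω, (branchingProcess (ξ n) (ε n) j ω : ℝ) ∂P :=
      integral_nonneg fun _ => Nat.cast_nonneg _
    have h5 := (hKn (j + 1) h1).2
    exact mul_le_mul (pow_le_pow_left₀ (by positivity) h5 2)
      (mul_le_mul_of_nonneg_left h3 hbn) (mul_nonneg hbn h4) (by positivity)
  have hsum := Finset.sum_le_sum hterm
  rw [Finset.sum_const, Finset.card_range, nsmul_eq_mul] at hsum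
  have hsum' := hsum.trans (mul_le_mul_of_nonneg_right hfl (by positivity))
  refine (div_le_div_of_nonneg_right hsum' (by positivity)).trans_eq ?_
  field_simp

end Asymptotics

/-! ### Assembly of the functional limit theorem -/

/-- The factors will be `c ^ k`, the discounted sum and `n α(n) / A(n)`. The middle one carries
`3η`: one `η` from the noise and two from the interpolation between grid times. -/
theorem abs_mul_mul_sub_le {x y z x' y' z' M N Q η : ℝ} (hη : η ≤ 1) (hx' : |x'| ≤ M)
    (hy' : |y'| ≤ N) (hz' : |z'| ≤ Q) (hx : |x - x'| ≤ η) (hy : |y - y'| ≤ 3 * η)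
    (hz : |z - z'| ≤ η) :
    |x * y * z - x' * y' * z'| ≤ η * ((N + 3) * (Q + 1) + 3 * M * (Q + 1) + M * N) := by
  have hη0 : 0 ≤ η := (abs_nonneg _).trans hx
  have hM : 0 ≤ M := (abs_nonneg _).trans hx'
  have hN : 0 ≤ N := (abs_nonneg _).trans hy'
  have hQ : 0 ≤ Q := (abs_nonneg _).trans hz'
  have hyN : |y| ≤ N + 3 := by
    have := abs_sub_abs_le_abs_sub y y'
    linarith
  have hzQ : |z| ≤ Q + 1 := by
    have := abs_sub_abs_le_abs_sub z z'
    linarith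
  have e : x * y * z - x' * y' * z' =
      (x - x') * (y * z) + x' * ((y - y') * z) + x' * (y' * (z - z')) := by ring
  rw [e]
  refine (abs_add_three _ _ _).trans ?_
  simp only [abs_mul]
  calc |x - x'| * (|y| * |z|) + |x'| * (|y - y'| * |z|) + |x'| * (|y'| * |z - z'|)
      ≤ η * ((N + 3) * (Q + 1)) + M * (3 * η * (Q + 1)) + M * (N * η) := by gcongr
    _ = _ := by ring

theorem theorem1 {Ω : Type*} [MeasurableSpace Ω] (P : Measure Ω) [IsProbabilityMeasure P]
    -- offspring numbers `ξ n k j` and immigration `ε n k` of the `n`-th process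
    (ξ : ℕ+ → ℕ+ → ℕ+ → Ω → ℕ) (ε : ℕ+ → ℕ+ → Ω → ℕ)
    (hξ_meas : ∀ n k j, Measurable (ξ n k j))
    (hε_meas : ∀ n k, Measurable (ε n k))
    -- for each `n`, the offspring numbers are i.i.d. with finite mean and variance
    (hξ_indep : ∀ n, iIndepFun (fun p : ℕ+ × ℕ+ => ξ n p.1 p.2) P)
    (hξ_ident : ∀ n k j, IdentDistrib (ξ n k j) (ξ n 1 1) P P)
    (hξ_L2 : ∀ n, MemLp (fun ω => (ξ n 1 1 ω : ℝ)) 2 P)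
    -- the immigration has finite means and variances
    (hε_L2 : ∀ n k, MemLp (fun ω => (ε n k ω : ℝ)) 2 P)
    -- for each `n`, the families of offspring and immigration numbers are independent
    (hξε : ∀ n, IndepFun (fun ω (p : ℕ+ × ℕ+) => ξ n p.1 p.2 ω) (fun ω k => ε n k ω) P)
    -- rowwise `ψ`-mixing immigration
    (hmix : ∀ n, IsPsiMixing P (ε n))
    (hmix_sum : (⨆ n : ℕ+, ∑' k : ℕ+, psiMixingCoeff P (ε n) k) < ∞)
    (a α β : ℝ) (hα : 0 ≤ α) (hβ : 0 ≤ β) (αseq βseq : ℕ+ → ℝ)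
    -- regularly varying approximation of the immigration means and variances
    (hαseq : IsRegularlyVaryingSeq α αseq)
    (hβseq : IsRegularlyVaryingSeq β βseq)
    (hmean : RowsApproximate (fun n k => ∫ ω, (ε n k ω : ℝ) ∂P) αseq)
    (hvar : RowsApproximate (fun n k => variance (fun ω => (ε n k ω : ℝ)) P) βseq)
    -- offspring means: `a_n = 1 + a / n + o(1 / n)`
    (h_offspring_mean : (fun n : ℕ+ => (∫ ω, (ξ n 1 1 ω : ℝ) ∂P) - (1 + a * (n : ℝ)⁻¹))
      =o[atTop] fun n : ℕ+ => (n : ℝ)⁻¹)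
    -- offspring variances: `b_n = o(α(n))`
    (h_offspring_var : (fun n : ℕ+ => variance (fun ω => (ξ n 1 1 ω : ℝ)) P) =o[atTop] αseq)
    -- `α(n) → ∞` and `β(n) = o(n α(n)^2)`
    (hα_top : Tendsto αseq atTop atTop)
    (hβ_small : βseq =o[atTop] fun n : ℕ+ => (n : ℝ) * αseq n ^ 2) :
    TendstoInDistribution
      (fun (n : ℕ+) (ω : Ω) => normalizedPath P n (branchingProcess (ξ n) (ε n)) ω)
      atTop (fun _ : Ω => piPath a α hα) (fun _ => P) P := by
  set c : ℕ+ → ℝ := fun n => ∫ ω, (ξ n 1 1 ω : ℝ) ∂P with hc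
  obtain ⟨hpos, hlog⟩ := tendsto_mul_log_of_isLittleO h_offspring_mean
  have hε_int : ∀ n k, Integrable (fun ω => (ε n k ω : ℝ)) P := fun n k =>
    (hε_L2 n k).integrable one_le_two
  set B : ℕ+ → ℝ := fun n => n * αseq n with hB
  have hBpos : ∀ n, 0 < B n := fun n => mul_pos n.cast_real_pos (hαseq.pos n)
  set A : ℕ+ → ℝ := fun n => ∫ ω, (branchingProcess (ξ n) (ε n) n ω : ℝ) ∂P with hA
  set ν := discountedMu a α with hν
  have hνc : Continuous ν := continuous_discountedMu a hα
  have hAB : Tendsto (fun n => B n / A n) atTop (𝓝 (Real.exp a * ν 1)⁻¹) := by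
    have h1 := hmean.tendsto_weighted_sum hαseq hα hpos hlog (t := 1) zero_le_one
    have h2 : Tendsto (fun n : ℕ+ => c n ^ (n : ℕ)) atTop (𝓝 (Real.exp a)) := by
      refine ((Real.continuous_exp.tendsto a).comp hlog).congr' ?_
      filter_upwards [hpos] with n hn
      rw [pow_eq_exp_div_mul hn n, div_self n.cast_real_pos.ne', one_mul]
      rfl
    refine ((h2.mul h1).inv₀
      (mul_pos (Real.exp_pos a) (discountedMu_pos a hα one_pos)).ne').congr' ?_
    filter_upwards [hpos] with n hn
    simp only [hA, hB]
    rw [integral_branchingProcess_eq_sum (hξ_meas n) (hε_meas n) (hξ_indep n) (hξε n)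
        (hξ_ident n) (hξ_L2 n) (hε_int n) rfl rfl hn.ne', mul_one, Nat.floor_natCast,
        ← mul_div_assoc, inv_div]
  refine tendstoInDistribution_const_of_tendsto_measure (fun n => ?_) fun δ hδ => ?_
  · refine ((measurable_stepPath n).comp (measurable_pi_lambda _ fun k => ?_)).aemeasurable
    exact (measurable_of_countable fun x : ℕ => (x : ℝ) / A n).comp
      ((measurable_branchingProcess_filtration (hξ_meas n) (hε_meas n) k).mono
        ((branchingFiltration (ξ n) (ε n) (hξ_meas n) (hε_meas n)).le k) le_rfl)
  -- The set `nearby δ` constrains paths only on `[0, 1/δ]`.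
  set T : ℝ := 1 / δ
  have hT : 0 ≤ T := by positivity
  obtain ⟨N, hN⟩ := (isCompact_Icc (a := (0 : ℝ)) (b := T)).exists_bound_of_continuousOn
    hνc.continuousOn
  have hN0 : 0 ≤ N := (norm_nonneg _).trans (hN 0 ⟨le_rfl, hT⟩)
  set M := Real.exp (|a| * T) with hM
  set q := (Real.exp a * ν 1)⁻¹ with hq
  have hq0 : 0 < q := inv_pos.mpr (mul_pos (Real.exp_pos a) (discountedMu_pos a hα one_pos))
  set L := (N + 3) * (q + 1) + 3 * M * (q + 1) + M * N
  have hL : 0 < L := by positivity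
  set η := min 1 (δ / L)
  have hη : 0 < η := by positivity
  obtain ⟨G, hG0, hG⟩ := exists_finset_abs_sub_le_of_monotoneOn hνc T hη
  have hnoise := tendsto_measure_branchingNoise hξ_meas hε_meas hξ_indep hξ_ident hξ_L2 hε_int hξε
    hα hαseq hmean (fun _ => rfl) (fun _ => rfl) h_offspring_var hpos hlog hT hη
  have himm := tendsto_finsetSum G fun t ht => tendsto_measure_discounted_immigration hε_meas hε_L2
    hmix_sum hα hβ hαseq hβseq hmean hvar hβ_small hpos hlog (hG0 t ht) hη
  have hbound := hnoise.add himm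
  rw [Finset.sum_const_zero, add_zero] at hbound
  refine tendsto_of_tendsto_of_tendsto_of_le_of_le' tendsto_const_nhds hbound
    (Eventually.of_forall fun _ => zero_le) ?_
  filter_upwards [hpos, eventually_abs_pow_floor_sub_exp_le hpos hlog (T := T) hη,
    Metric.tendsto_nhds.mp hAB η hη] with n hcn hexp hABn
  refine le_trans (measure_mono fun ω hω => ?_)
    ((measure_union_le _ _).trans (add_le_add_right (measure_biUnion_finset_le G _) _))
  by_contra hgood
  rw [Set.mem_union, not_or] at hgood
  obtain ⟨hg1, hg2⟩ := hgood
  simp only [Set.mem_iUnion, not_exists] at hg2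
  refine hω ⟨OrderIso.refl _, fun s => by simpa using hδ.le, fun s hs => ?_⟩
  have hs0 : (0 : ℝ) ≤ s := s.coe_nonneg
  have hn0 := n.cast_real_pos
  have hBn := hBpos n
  have hinv := inv_pos.mpr hcn
  set k := ⌊(n : ℝ) * s⌋₊ with hk
  set S := ∑ j ∈ Finset.range k, (c n)⁻¹ ^ (j + 1) * branchingNoise (ξ n) (ε n) (c n) j ω
  set V : ℝ → ℝ := fun t => (∑ j ∈ Finset.range ⌊(n : ℝ) * t⌋₊,
    (c n)⁻¹ ^ (j + 1) * (ε n j.succPNat ω : ℝ)) / B n with hV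
  -- Immigration is nonnegative, so closeness at the finitely many times in `G` extends to all of
  -- `[0, T]`.
  have hVmono : MonotoneOn V (Set.Ici 0) := by
    intro t _ t' _ htt
    refine div_le_div_of_nonneg_right (Finset.sum_le_sum_of_subset_of_nonneg ?_ fun i _ _ => ?_)
      hBn.le
    · exact Finset.range_subset_range.mpr
        (Nat.floor_le_floor (mul_le_mul_of_nonneg_left htt hn0.le))
    · positivity
  have hVν : |V s - ν s| ≤ 2 * η := by
    refine hG V hVmono (fun t ht => ?_) s ⟨hs0, hs⟩
    exact (not_le.mp fun h => hg2 t ht h).le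
  have hS : |S / B n| ≤ η := by
    rw [abs_div, abs_of_pos hBn, div_le_iff₀ hBn]
    by_contra! h
    exact hg1 ⟨k, Nat.floor_le_floor (mul_le_mul_of_nonneg_left hs hn0.le), h.le⟩
  have hSV : |(S / B n + V s) - ν s| ≤ 3 * η := by
    rw [add_sub_assoc]
    exact (abs_add_le _ _).trans (by linarith)
  have hx' : |Real.exp (a * s)| ≤ M := by
    rw [Real.abs_exp]
    exact Real.exp_le_exp.mpr ((mul_le_mul_of_nonneg_right (le_abs_self a) hs0).trans
      (mul_le_mul_of_nonneg_left hs (abs_nonneg _)))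
  have key := abs_mul_mul_sub_le (min_le_left _ _) hx' (hN s ⟨hs0, hs⟩) (abs_of_pos hq0).le
    (hexp s ⟨hs0, hs⟩) hSV hABn.le
  have hleft : (normalizedPath P n (branchingProcess (ξ n) (ε n)) ω).toFun s =
      c n ^ k * (S / B n + V s) * (B n / A n) := by
    change (branchingProcess (ξ n) (ε n) ⌊((n : ℕ) : ℝ≥0) * s⌋₊ ω : ℝ) / A n = _
    rw [NNReal.floor_eq_floor_coe, NNReal.coe_mul, NNReal.coe_natCast, ← hk,
      branchingProcess_eq_sum (c := c n) (ne_of_gt hcn)]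
    simp only [hV]
    rw [← add_div, ← hk, mul_assoc, div_mul_div_cancel₀ hBn.ne', ← mul_div_assoc]
  have hright : (piPath a α hα).toFun s = Real.exp (a * s) * ν s * q := by
    change muFun a α s / muFun a α 1 = _
    rw [muFun_eq_exp_mul, muFun_eq_exp_mul, mul_one, hq, div_eq_mul_inv]
  rw [OrderIso.refl_apply, hleft, hright]
  refine key.trans ?_
  calc η * L ≤ δ / L * L := mul_le_mul_of_nonneg_right (min_le_right _ _) hL.le
    _ = δ := div_mul_cancel₀ _ hL.ne'

end
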